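/- For integers $n\ge 1$, $k\ge 3$ and $0\le m\le\binom nk$, let $\Omega_{n,k}$ be the set of the $\binom nk$ vectors in $GF(2)^n$ with exactly $k$ entries equal to $1$, and let $\mathbf A_{n,m;k}$ be the random $n\times m$ matrix over $GF(2)$ whose columns form a uniformly random $m$-element subset of $\Omega_{n,k}$. Ranks are taken over $GF(2)$. Put $n^*=n-1$ if $k$ is even and $n^*=n$ if $k$ is odd. In both parts $k\ge 3$ is fixed and $n\to\infty$. (i) For every constant $A>0$ there is a constant $\gamma=\gamma(A)>0$ such that, for every fixed $k\ge 3$ and all integers $m=m(n)$ with $\gamma n\log n\le m\le\binom nk$ for all large $n$, $$\Pr\bigl(\mathrm{rank}(\mathbf A_{n,m;k})<n^*\bigr)=o(n^{-A})\qquad(n\to\infty).$$ (ii) Let $k\ge3$ be fixed, and let $m=m(n)$ be integers and $c_n$ real numbers with $m=n(\log n+c_n)/k$ and $0\le m\le\binom nk$ for all large $n$. Then $$\lim_{n\to\infty}\Pr\bigl(\mathrm{rank}(\mathbf A_{n,m;k})=n^*\bigr)=\begin{cases}0&\text{if }c_n\to-\infty,\\ e^{-e^{-c}}&\text{if }c_n\to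 c\in\mathbb R,\\ 1&\text{if }c_n\to+\infty.\end{cases}$$ -/

import Mathlib

open Filter Topology Asymptotics

namespace RandomBinaryMatrix

/-- `Ω_{n,k}`: the vectors of length `n` over the two-element field with exactly `k` entries
equal to `1`, all other entries being `0`. -/
def Omega (n k : ℕ) : Finset (Fin n → ZMod 2) :=
  Finset.univ.filter fun v => (Finset.univ.filter fun i => v i = 1).card = k

/-- The matrix over the two-element field, with `n` rows, whose columns are the vectors of the
finite set `C` (each one once, indexed by itself; the order of the columns does not affect the
rank). -/
def colMatrix {n : ℕ} (C : Finset (Fin n → ZMod 2)) : Matrix (Fin n) C (ZMod 2) :=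
  Matrix.of fun i c => c.1 i

/-- `n^* = n - 1` if `k` is even and `n^* = n` if `k` is odd. -/
def nStar (n k : ℕ) : ℕ := if Even k then n - 1 else n

open Classical in
/-- The probability that the rank over the two-element field of `A_{n,m;k}` satisfies `P`, where
the set of columns of `A_{n,m;k}` is a uniformly random `m`-element subset of `Ω_{n,k}`. It is
meaningful for `m ≤ n.choose k`, when there is such a subset. -/
noncomputable def probRank (n m k : ℕ) (P : ℕ → Prop) : ℝ :=
  ((((Omega n k).powersetCard m).filter fun C => P (colMatrix C).rank).card : ℝ) /
    (((Omega n k).powersetCard m).card : ℝ)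

end RandomBinaryMatrix

/-!
A matrix over the two-element field is rank deficient exactly if some nonempty set `S` of rows
adds up to zero, where for even `k` the set of all rows has to be left out (`Deficient`). In terms
of the supports of the columns, every column has to meet `S` in an even number of points. So the
columns all have to be drawn from a certain subset of `Ω_{n,k}`, and if a fraction `q` of the
`k`-sets meets `S` in an odd number of points, this has probability at most `exp (- q m)`.

If `S` has more than `n / (4 k)` elements (and at most `n / 2` of them for even `k`, which can be
assumed by passing to the complement), then `q` is bounded below by a constant
(`large_card_odd`), and `2 ^ n exp (- q m)` is tiny once `m` is of order `n log n`. If `S` has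
`s ≤ n / (4 k)` elements, then `q ≥ (k s / n) (1 - k s / n)` (`small_card_odd`). The union bound
over `S` then gives the first part, where `γ = A + 3` works.

At `m = n (log n + c) / k` the union bound over small `S` does not tend to zero, but only because
of the zero rows: every set of zero rows adds up to zero. Without zero rows, some column must meet
`S` in at least two points, which costs another factor of order `s² log n / n`, and the sum over
the small `S` tends to zero (`tendsto_subsetProb_deficient_not_hasZeroRow`). Hence the probability
of full rank has the same limit as the probability that there is no zero row. By
inclusion-exclusion the latter is an alternating series that is dominated by an exponential series
and whose terms tend to those of `exp (- exp (- c))` (`tendsto_subsetProb_not_hasZeroRow`).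

The cases `c → ± ∞` follow from the case of a constant `c`, as the probability of full rank grows
with the number of columns (`probRank_eq_nStar_mono`).
-/

namespace RandomBinaryMatrix

open Finset

/-! ### Ratios of binomial coefficients -/

theorem descFactorial_mul_pow_le {a N : ℕ} (h : a ≤ N) (m : ℕ) :
    a.descFactorial m * N ^ m ≤ a ^ m * N.descFactorial m := by
  induction m with
  | zero => simp
  | succ m ih =>
    rw [Nat.descFactorial_succ, Nat.descFactorial_succ, pow_succ, pow_succ]
    have h1 : (a - m) * N ≤ a * (N - m) := by
      rw [Nat.sub_mul, Nat.mul_sub]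
      have : a * m ≤ m * N := by rw [mul_comm a m]; exact Nat.mul_le_mul_left m h
      omega
    calc (a - m) * a.descFactorial m * (N ^ m * N)
        = ((a - m) * N) * (a.descFactorial m * N ^ m) := by ring
      _ ≤ (a * (N - m)) * (a ^ m * N.descFactorial m) := Nat.mul_le_mul h1 ih
      _ = _ := by ring

theorem choose_div_choose_eq (a N m : ℕ) :
    (a.choose m : ℝ) / N.choose m = (a.descFactorial m : ℝ) / N.descFactorial m := by
  rw [Nat.descFactorial_eq_factorial_mul_choose, Nat.descFactorial_eq_factorial_mul_choose]
  push_cast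
  rw [mul_div_mul_left _ _ (by positivity)]

theorem choose_div_choose_le_pow {a N : ℕ} (h : a ≤ N) (m : ℕ) :
    (a.choose m : ℝ) / N.choose m ≤ ((a : ℝ) / N) ^ m := by
  rw [choose_div_choose_eq, div_pow]
  rcases Nat.eq_zero_or_pos (N.descFactorial m) with h0 | h0
  · rw [h0]; simp; positivity
  rcases Nat.eq_zero_or_pos N with hN | hN
  · subst hN
    obtain rfl : a = 0 := by omega
    cases m <;> simp
  rw [div_le_div_iff₀ (by exact_mod_cast h0) (by positivity)]
  exact_mod_cast descFactorial_mul_pow_le h m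

theorem sub_pow_mul_descFactorial_le {M N m : ℕ} (h : M ≤ N) (hm : m ≤ M) {j : ℕ} (hj : j ≤ m) :
    (M - m) ^ j * N.descFactorial j ≤ M.descFactorial j * (N - m) ^ j := by
  induction j with
  | zero => simp
  | succ j ih =>
    rw [Nat.descFactorial_succ, Nat.descFactorial_succ, pow_succ, pow_succ]
    have h1 : (M - m) * (N - j) ≤ (M - j) * (N - m) := by
      obtain ⟨p, rfl⟩ := Nat.exists_eq_add_of_le h
      obtain ⟨q, rfl⟩ := Nat.exists_eq_add_of_le hm
      obtain ⟨r, rfl⟩ := Nat.exists_eq_add_of_le (Nat.le_of_succ_le hj)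
      rw [show j + r + q - (j + r) = q by omega, show j + r + q + p - j = r + q + p by omega,
        show j + r + q - j = r + q by omega, show j + r + q + p - (j + r) = q + p by omega]
      nlinarith [Nat.zero_le (r * p)]
    calc (M - m) ^ j * (M - m) * ((N - j) * N.descFactorial j)
        = ((M - m) * (N - j)) * ((M - m) ^ j * N.descFactorial j) := by ring
      _ ≤ ((M - j) * (N - m)) * (M.descFactorial j * (N - m) ^ j) :=
          Nat.mul_le_mul h1 (ih (by omega))
      _ = _ := by ring

theorem pow_le_choose_div_choose {M N m : ℕ} (h : M ≤ N) (hm : m ≤ M) (hN : m < N) :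
    (1 - ((N : ℝ) - M) / (N - m)) ^ m ≤ (M.choose m : ℝ) / N.choose m := by
  have hpos : (0 : ℝ) < N - m := by
    have : (m : ℝ) < N := by exact_mod_cast hN
    linarith
  have h0 : 0 < N.descFactorial m := Nat.descFactorial_pos.2 hN.le
  rw [choose_div_choose_eq, show 1 - ((N : ℝ) - M) / (N - m) = ((M : ℝ) - m) / (N - m) by
    field_simp; ring, div_pow, div_le_div_iff₀ (by positivity) (by exact_mod_cast h0)]
  have := sub_pow_mul_descFactorial_le h hm le_rfl
  rw [← Nat.cast_sub hm, ← Nat.cast_sub hN.le]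
  exact_mod_cast this

/-! ### Random subsets of a finite set -/

section

variable {α : Type*}

open Classical in
/-- The probability that a uniformly random `m`-element subset of `Ω` satisfies `Q`. It takes the
junk value `0` if `Ω` has fewer than `m` elements. -/
noncomputable def subsetProb (Ω : Finset α) (m : ℕ) (Q : Finset α → Prop) : ℝ :=
  #{C ∈ Ω.powersetCard m | Q C} / #(Ω.powersetCard m)

theorem subsetProb_eq (Ω : Finset α) (m : ℕ) (Q : Finset α → Prop) [DecidablePred Q] :
    subsetProb Ω m Q = (#{C ∈ Ω.powersetCard m | Q C} : ℝ) / (#Ω).choose m := by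
  unfold subsetProb
  rw [card_powersetCard]
  congr!

theorem subsetProb_nonneg (Ω : Finset α) (m : ℕ) (Q : Finset α → Prop) :
    0 ≤ subsetProb Ω m Q := by
  unfold subsetProb; positivity

theorem subsetProb_mono {Ω : Finset α} {m : ℕ} {P Q : Finset α → Prop}
    (h : ∀ C ∈ Ω.powersetCard m, P C → Q C) : subsetProb Ω m P ≤ subsetProb Ω m Q := by
  classical
  unfold subsetProb
  gcongr 1
  exact_mod_cast card_le_card fun C hC => by
    rw [mem_filter] at hC ⊢
    exact ⟨hC.1, h C hC.1 hC.2⟩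

theorem subsetProb_congr {Ω : Finset α} {m : ℕ} {P Q : Finset α → Prop}
    (h : ∀ C ∈ Ω.powersetCard m, P C ↔ Q C) : subsetProb Ω m P = subsetProb Ω m Q :=
  le_antisymm (subsetProb_mono fun C hC => (h C hC).1) (subsetProb_mono fun C hC => (h C hC).2)

theorem subsetProb_or_le (Ω : Finset α) (m : ℕ) (P Q : Finset α → Prop) :
    subsetProb Ω m (fun C => P C ∨ Q C) ≤ subsetProb Ω m P + subsetProb Ω m Q := by
  classical
  rw [subsetProb_eq, subsetProb_eq, subsetProb_eq, ← add_div]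
  gcongr
  rw [filter_or]
  exact_mod_cast card_union_le _ _

theorem subsetProb_exists_le {ι : Type*} (Ω : Finset α) (m : ℕ) (s : Finset ι)
    (Q : ι → Finset α → Prop) :
    subsetProb Ω m (fun C => ∃ i ∈ s, Q i C) ≤ ∑ i ∈ s, subsetProb Ω m (Q i) := by
  classical
  simp_rw [subsetProb_eq]
  rw [← Finset.sum_div]
  gcongr
  calc (#{C ∈ Ω.powersetCard m | ∃ i ∈ s, Q i C} : ℝ)
      ≤ #(s.biUnion fun i => {C ∈ Ω.powersetCard m | Q i C}) := by
        exact_mod_cast card_le_card fun C hC => by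
          simp only [mem_filter, mem_biUnion] at hC ⊢
          obtain ⟨h, i, hi, hQ⟩ := hC
          exact ⟨i, hi, h, hQ⟩
    _ ≤ ((∑ i ∈ s, #{C ∈ Ω.powersetCard m | Q i C} : ℕ) : ℝ) := by
        exact_mod_cast card_biUnion_le
    _ = _ := by push_cast; rfl

theorem subsetProb_subset {Ω F : Finset α} (hF : F ⊆ Ω) (m : ℕ) :
    subsetProb Ω m (fun C => C ⊆ F) = ((#F).choose m : ℝ) / (#Ω).choose m := by
  classical
  rw [subsetProb_eq]
  congr 2
  rw [← card_powersetCard]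
  congr 1
  ext C
  simp only [mem_filter, mem_powersetCard]
  exact ⟨fun h => ⟨h.2, h.1.2⟩, fun h => ⟨⟨h.1.trans hF, h.2⟩, h.1⟩⟩

theorem subsetProb_subset_le {Ω F : Finset α} (hF : F ⊆ Ω) (m : ℕ) :
    subsetProb Ω m (fun C => C ⊆ F) ≤ ((#F : ℝ) / #Ω) ^ m := by
  rw [subsetProb_subset hF]
  exact choose_div_choose_le_pow (card_le_card hF) m

/-- A random `m`-subset lies in `F` but not in `G` only if it contains some element of `F \ G`
and its other `m - 1` elements also lie in `F`. -/
theorem subsetProb_subset_not_subset_le [DecidableEq α] {Ω F : Finset α} (hF : F ⊆ Ω)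
    (G : Finset α) {m : ℕ} (hm : m ≤ #Ω) :
    subsetProb Ω m (fun C => C ⊆ F ∧ ¬ C ⊆ G) ≤
      (#(F \ G) : ℝ) * (m / #Ω) * ((#F : ℝ) / #Ω) ^ (m - 1) := by
  classical
  rcases Nat.eq_zero_or_pos m with rfl | hm0
  · have : subsetProb Ω 0 (fun C => C ⊆ F ∧ ¬ C ⊆ G) = 0 := by
      unfold subsetProb
      simp
    rw [this]; positivity
  have hΩ : 0 < #Ω := by omega
  have hone : ∀ e ∈ F, subsetProb Ω m (fun C => e ∈ C ∧ C ⊆ F) ≤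
      (m / #Ω : ℝ) * ((#F : ℝ) / #Ω) ^ (m - 1) := by
    intro e he
    have hcard : #{C ∈ Ω.powersetCard m | e ∈ C ∧ C ⊆ F} = (#F - 1).choose (m - 1) := by
      have := card_filter_powersetCard_subset {e} F m (by simpa using he) (by rw [card_singleton]; exact hm0)
      rw [card_singleton] at this
      rw [← this]
      congr 1
      ext C
      simp only [mem_filter, mem_powersetCard, singleton_subset_iff]
      exact ⟨fun h => ⟨⟨h.2.2, h.1.2⟩, h.2.1⟩, fun h => ⟨⟨h.1.1.trans hF, h.1.2⟩, h.2, h.1.1⟩⟩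
    have hFpos : 0 < #F := card_pos.2 ⟨e, he⟩
    have hle := card_le_card hF
    obtain ⟨j, rfl⟩ : ∃ j, m = j + 1 := ⟨m - 1, by omega⟩
    obtain ⟨N, hN⟩ : ∃ N, #Ω = N + 1 := ⟨#Ω - 1, by omega⟩
    obtain ⟨f, hf⟩ : ∃ f, #F = f + 1 := ⟨#F - 1, by omega⟩
    rw [subsetProb_eq, hcard, hN, hf]
    simp only [Nat.add_sub_cancel]
    have habs : ((N + 1).choose (j + 1) : ℝ) * (j + 1) = (N + 1) * N.choose j := by
      exact_mod_cast (Nat.add_one_mul_choose_eq N j).symm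
    have hNj : (0 : ℝ) < N.choose j := by exact_mod_cast Nat.choose_pos (by omega)
    have h1 : (f.choose j : ℝ) / (N + 1).choose (j + 1) =
        ((j + 1 : ℕ) / (N + 1 : ℕ) : ℝ) * (f.choose j / N.choose j) := by
      have : (0 : ℝ) < (N + 1).choose (j + 1) := by exact_mod_cast Nat.choose_pos (by omega)
      push_cast
      rw [div_mul_div_comm, div_eq_div_iff (by positivity) (by positivity), ← habs]
      ring
    rw [h1]
    have hfN : f ≤ N := by omega
    gcongr
    refine (choose_div_choose_le_pow hfN j).trans ?_
    gcongr ?_ ^ j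
    rcases Nat.eq_zero_or_pos N with hz | hz
    · subst hz; simp; positivity
    rw [div_le_div_iff₀ (by positivity) (by positivity)]
    push_cast
    have : (f : ℝ) ≤ N := by exact_mod_cast hfN
    nlinarith
  calc subsetProb Ω m (fun C => C ⊆ F ∧ ¬ C ⊆ G)
      ≤ subsetProb Ω m (fun C => ∃ e ∈ F \ G, e ∈ C ∧ C ⊆ F) := by
        refine subsetProb_mono fun C _ h => ?_
        obtain ⟨e, he, heG⟩ := not_subset.1 h.2
        exact ⟨e, Finset.mem_sdiff.2 ⟨h.1 he, heG⟩, he, h.1⟩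
    _ ≤ ∑ e ∈ F \ G, subsetProb Ω m (fun C => e ∈ C ∧ C ⊆ F) := subsetProb_exists_le ..
    _ ≤ ∑ _e ∈ F \ G, (m / #Ω : ℝ) * ((#F : ℝ) / #Ω) ^ (m - 1) :=
        sum_le_sum fun e he => hone e (Finset.mem_sdiff.1 he).1
    _ = _ := by rw [sum_const, nsmul_eq_mul]; ring

theorem subsetProb_le_succ {Ω : Finset α} {m : ℕ} (hm : m < #Ω) {Q : Finset α → Prop}
    (hQ : ∀ C D, C ⊆ D → Q C → Q D) : subsetProb Ω m Q ≤ subsetProb Ω (m + 1) Q := by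
  classical
  rw [subsetProb_eq, subsetProb_eq]
  have h1 : (0 : ℝ) < (#Ω).choose m := by exact_mod_cast Nat.choose_pos hm.le
  have h2 : (0 : ℝ) < (#Ω).choose (m + 1) := by exact_mod_cast Nat.choose_pos hm
  have key := card_mul_le_card_mul (s := {C ∈ Ω.powersetCard m | Q C})
    (t := {C ∈ Ω.powersetCard (m + 1) | Q C}) (m := #Ω - m) (n := m + 1) (fun C D => C ⊆ D)
    (by
      intro C hC
      simp only [mem_filter, mem_powersetCard] at hC
      rw [← hC.1.2, ← card_sdiff_of_subset hC.1.1]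
      refine card_le_card_of_injOn (fun e => insert e C) ?_ ?_
      · intro e he
        simp only [mem_coe, Finset.mem_sdiff] at he
        simp only [mem_coe, bipartiteAbove, mem_filter, mem_powersetCard]
        refine ⟨⟨⟨insert_subset he.1 hC.1.1, ?_⟩, hQ C _ (subset_insert _ _) hC.2⟩,
          subset_insert _ _⟩
        rw [card_insert_of_notMem he.2]
      · intro e he f hf hef
        simp only [mem_coe, Finset.mem_sdiff] at he hf
        have : e ∈ insert f C := by
          have h := mem_insert_self e C
          simp only at hef
          rwa [hef] at h
        rcases mem_insert.1 this with h | h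
        · exact h
        · exact absurd h he.2)
    (by
      intro D hD
      simp only [mem_filter, mem_powersetCard] at hD
      calc _ ≤ #(D.powersetCard m) := card_le_card fun C hC => by
              simp only [bipartiteBelow, mem_filter, mem_powersetCard] at hC ⊢
              exact ⟨hC.2, hC.1.1.2⟩
        _ = m + 1 := by rw [card_powersetCard, hD.1.2]; simp)
  rw [div_le_div_iff₀ h1 h2]
  have hch : ((#Ω).choose (m + 1) : ℝ) * (m + 1) = (#Ω).choose m * ((#Ω - m : ℕ) : ℝ) := by
    exact_mod_cast Nat.choose_succ_right_eq (#Ω) m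
  have keyR : (#{C ∈ Ω.powersetCard m | Q C} : ℝ) * ((#Ω - m : ℕ) : ℝ) ≤
      #{C ∈ Ω.powersetCard (m + 1) | Q C} * (m + 1) := by exact_mod_cast key
  have hpos : (0 : ℝ) < m + 1 := by positivity
  refine le_of_mul_le_mul_right ?_ hpos
  calc (#{C ∈ Ω.powersetCard m | Q C} : ℝ) * (#Ω).choose (m + 1) * (m + 1)
      = (#{C ∈ Ω.powersetCard m | Q C} : ℝ) * ((#Ω - m : ℕ) : ℝ) * (#Ω).choose m := by
        rw [mul_assoc, hch]; ring
    _ ≤ #{C ∈ Ω.powersetCard (m + 1) | Q C} * (m + 1) * (#Ω).choose m := by gcongr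
    _ = _ := by ring

/-- The probability of an upward closed property of a random subset grows with its size. -/
theorem subsetProb_mono_card {Ω : Finset α} {Q : Finset α → Prop}
    (hQ : ∀ C D, C ⊆ D → Q C → Q D) {m m' : ℕ} (h : m ≤ m') (hm' : m' ≤ #Ω) :
    subsetProb Ω m Q ≤ subsetProb Ω m' Q := by
  induction m', h using Nat.le_induction with
  | base => exact le_rfl
  | succ j hj ih => exact (ih (by omega)).trans (subsetProb_le_succ (by omega) hQ)

end

/-! ### Parity of the intersections of `k`-sets with a fixed set -/

section

variable {n k : ℕ}

theorem sum_card_inter (hk : 1 ≤ k) (S : Finset (Fin n)) :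
    ∑ e ∈ powersetCard k (univ : Finset (Fin n)), #(e ∩ S) = #S * (n - 1).choose (k - 1) := by
  have h : ∀ e : Finset (Fin n), #(e ∩ S) = ∑ v ∈ S, if v ∈ e then 1 else 0 := by
    intro e
    rw [inter_comm, ← filter_mem_eq_inter, card_filter]
  simp_rw [h]
  rw [sum_comm]
  rw [sum_congr rfl (g := fun _ => (n - 1).choose (k - 1)), sum_const, smul_eq_mul]
  intro v _
  rw [← card_filter]
  have := card_filter_powersetCard_subset {v} univ k (subset_univ _) (by rwa [card_singleton])
  simpa using this

theorem sum_card_offDiag_inter (hk : 2 ≤ k) (S : Finset (Fin n)) :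
    ∑ e ∈ powersetCard k (univ : Finset (Fin n)), #(e ∩ S).offDiag =
      #S.offDiag * (n - 2).choose (k - 2) := by
  have h : ∀ e : Finset (Fin n), #(e ∩ S).offDiag =
      ∑ p ∈ S.offDiag, if {p.1, p.2} ⊆ e then 1 else 0 := by
    intro e
    rw [← card_filter]
    congr 1
    ext p
    simp only [mem_offDiag, mem_inter, mem_filter, insert_subset_iff, singleton_subset_iff]
    tauto
  simp_rw [h]
  rw [sum_comm]
  rw [sum_congr rfl (g := fun _ => (n - 2).choose (k - 2)), sum_const, smul_eq_mul]
  intro p hp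
  rw [← card_filter]
  have hc : #({p.1, p.2} : Finset (Fin n)) = 2 := card_pair (mem_offDiag.1 hp).2.2
  have := card_filter_powersetCard_subset {p.1, p.2} univ k (subset_univ _) (by rwa [hc])
  rw [hc] at this
  simpa using this

theorem sum_card_inter_real (hk : 1 ≤ k) (hn : 1 ≤ n) (S : Finset (Fin n)) :
    ∑ e ∈ powersetCard k (univ : Finset (Fin n)), (#(e ∩ S) : ℝ) =
      n.choose k * (k * #S / n) := by
  rw [← Nat.cast_sum, sum_card_inter hk]
  obtain ⟨p, rfl⟩ := Nat.exists_eq_add_of_le' hn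
  obtain ⟨j, rfl⟩ := Nat.exists_eq_add_of_le' hk
  have h : ((p : ℝ) + 1) * p.choose j = (p + 1).choose (j + 1) * (j + 1) := by
    exact_mod_cast Nat.add_one_mul_choose_eq p j
  simp only [Nat.add_sub_cancel]
  push_cast
  have : ((p : ℝ) + 1) ≠ 0 := by positivity
  field_simp
  linear_combination (#S : ℝ) * h

theorem sum_card_mul_pred_inter_le (hk : 2 ≤ k) (hn : 2 ≤ n) (S : Finset (Fin n)) :
    ∑ e ∈ powersetCard k (univ : Finset (Fin n)), (#(e ∩ S) : ℝ) * (#(e ∩ S) - 1) ≤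
      n.choose k * (k * #S / n) * ((k - 1) * #S / n) := by
  have h0 : ∀ T : Finset (Fin n), (#T : ℝ) * (#T - 1) = (#T.offDiag : ℕ) := by
    intro T
    rw [offDiag_card, Nat.cast_sub (Nat.le_mul_self _)]
    push_cast; ring
  simp_rw [h0]
  rw [← Nat.cast_sum, sum_card_offDiag_inter hk, Nat.cast_mul, ← h0]
  have hs : #S ≤ n := by simpa using card_le_univ S
  obtain ⟨p, rfl⟩ := Nat.exists_eq_add_of_le' hn
  obtain ⟨j, rfl⟩ := Nat.exists_eq_add_of_le' hk
  have h1 : ((p : ℝ) + 1) * p.choose j = (p + 1).choose (j + 1) * (j + 1) := by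
    exact_mod_cast Nat.add_one_mul_choose_eq p j
  have h2 : ((p : ℝ) + 2) * (p + 1).choose (j + 1) = (p + 2).choose (j + 2) * (j + 2) := by
    exact_mod_cast Nat.add_one_mul_choose_eq (p + 1) (j + 1)
  simp only [Nat.add_sub_cancel]
  have hC : (p.choose j : ℝ) = (p + 2).choose (j + 2) * ((j + 2) / (p + 2)) * ((j + 1) / (p + 1)) := by
    have e1 : ((p : ℝ) + 1) ≠ 0 := by positivity
    have e2 : ((p : ℝ) + 2) ≠ 0 := by positivity
    field_simp
    linear_combination ((p : ℝ) + 2) * h1 + ((j : ℝ) + 1) * h2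
  have hs' : (#S : ℝ) ≤ p + 2 := by exact_mod_cast hs
  have key : ((#S : ℝ) - 1) / (p + 1) ≤ #S / (p + 2) := by
    rw [div_le_div_iff₀ (by positivity) (by positivity)]
    nlinarith
  rw [hC]
  push_cast
  calc (#S : ℝ) * (#S - 1) *
        ((p + 2).choose (j + 2) * ((j + 2) / (p + 2)) * ((j + 1) / (p + 1)))
      = ((p + 2).choose (j + 2) * ((j + 2) * #S / (p + 2)) * (j + 1)) *
          ((#S - 1) / (p + 1)) := by ring
    _ ≤ ((p + 2).choose (j + 2) * ((j + 2) * #S / (p + 2)) * (j + 1)) *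
          (#S / (p + 2)) := by gcongr
    _ = _ := by ring

/-- Most sets meeting a small set `S` meet it in a single point: by the Bonferroni-type inequality
`j - j (j - 1) ≤ [j = 1]`, the first two factorial moments give a lower bound for the number of
sets that meet `S` in an odd number of points. -/
theorem le_card_odd_of_moments (hk : 2 ≤ k) (hn : 2 ≤ n) (S : Finset (Fin n)) :
    (n.choose k : ℝ) * (k * #S / n) * (1 - (k - 1) * #S / n) ≤
      #{e ∈ powersetCard k (univ : Finset (Fin n)) | Odd #(e ∩ S)} := by
  have h1 := sum_card_inter_real (by omega : 1 ≤ k) (by omega : 1 ≤ n) S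
  have h2 := sum_card_mul_pred_inter_le hk hn S
  have h3 : ∑ e ∈ powersetCard k (univ : Finset (Fin n)),
      ((#(e ∩ S) : ℝ) - #(e ∩ S) * (#(e ∩ S) - 1)) ≤
      #{e ∈ powersetCard k (univ : Finset (Fin n)) | Odd #(e ∩ S)} := by
    rw [card_filter]
    push_cast
    refine sum_le_sum fun e _ => ?_
    generalize #(e ∩ S) = j
    match j with
    | 0 => simp
    | 1 => simp
    | j + 2 =>
      have : (0 : ℝ) ≤ if Odd (j + 2) then 1 else 0 := by split_ifs <;> norm_num
      refine le_trans ?_ this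
      push_cast
      nlinarith [(Nat.cast_nonneg j : (0 : ℝ) ≤ j)]
  rw [sum_sub_distrib, h1] at h3
  calc _ = (n.choose k : ℝ) * (k * #S / n) -
        n.choose k * (k * #S / n) * ((k - 1) * #S / n) := by ring
    _ ≤ _ := by linarith

/-- Choose all but one of the points of a `k`-set: whatever the parity of their number in `S`,
the last point can be chosen in at least `t` ways so that the `k`-set meets `S` in an odd number
of points. -/
theorem choose_mul_le_card_odd_mul (hk : 1 ≤ k) (hkn : k ≤ n) (S : Finset (Fin n)) {t : ℕ}
    (h1 : t + (k - 1) ≤ #S) (h2 : t + (k - 1) ≤ n - #S) :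
    n.choose k * t ≤ #{e ∈ powersetCard k (univ : Finset (Fin n)) | Odd #(e ∩ S)} * n := by
  obtain ⟨j, rfl⟩ := Nat.exists_eq_add_of_le' hk
  simp only [Nat.add_sub_cancel] at h1 h2
  set O := {e ∈ powersetCard (j + 1) (univ : Finset (Fin n)) | Odd #(e ∩ S)} with hO
  have key : #(powersetCard j (univ : Finset (Fin n))) * t ≤ #O * (j + 1) := by
    refine card_mul_le_card_mul (fun f e => f ⊆ e) ?_ ?_
    · intro f hf
      have hfc : #f = j := (mem_powersetCard.1 hf).2
      obtain ⟨T, hT, hTf, hodd⟩ : ∃ T : Finset (Fin n), t ≤ #T ∧ (∀ v ∈ T, v ∉ f) ∧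
          ∀ v ∈ T, Odd #(insert v f ∩ S) := by
        rcases Nat.even_or_odd #(f ∩ S) with he | ho
        · refine ⟨S \ f, ?_, fun v hv => (Finset.mem_sdiff.1 hv).2, fun v hv => ?_⟩
          · have := le_card_sdiff f S
            omega
          · rw [Finset.mem_sdiff] at hv
            rw [insert_inter_of_mem hv.1, card_insert_of_notMem (by simp [hv.2])]
            exact he.add_one
        · refine ⟨Sᶜ \ f, ?_, fun v hv => (Finset.mem_sdiff.1 hv).2, fun v hv => ?_⟩
          · have := le_card_sdiff f Sᶜ
            rw [card_compl, Fintype.card_fin] at this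
            omega
          · rw [Finset.mem_sdiff, mem_compl] at hv
            rwa [insert_inter_of_notMem hv.1]
      refine hT.trans (card_le_card_of_injOn (fun v => insert v f) ?_ ?_)
      · intro v hv
        have hv : v ∈ T := hv
        simp only [mem_coe, bipartiteAbove, hO, mem_filter, mem_powersetCard]
        exact ⟨⟨⟨subset_univ _, by rw [card_insert_of_notMem (hTf v hv), hfc]⟩, hodd v hv⟩,
          subset_insert _ _⟩
      · intro v hv w hw hvw
        have hv : v ∈ T := hv
        have : v ∈ insert w f := by
          have h := mem_insert_self v f
          simp only at hvw
          rwa [hvw] at h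
        exact (mem_insert.1 this).resolve_right (hTf v hv)
    · intro e he
      have hec : #e = j + 1 := (mem_powersetCard.1 (mem_filter.1 he).1).2
      calc _ ≤ #(e.powersetCard j) := card_le_card fun f hf => by
              simp only [bipartiteBelow, mem_filter, mem_powersetCard] at hf ⊢
              exact ⟨hf.2, hf.1.2⟩
        _ = j + 1 := by rw [card_powersetCard, hec]; simp
  rw [card_powersetCard, card_univ, Fintype.card_fin] at key
  have hch := Nat.choose_succ_right_eq n j
  refine Nat.le_of_mul_le_mul_right ?_ (Nat.add_one_pos j)
  calc n.choose (j + 1) * t * (j + 1) = n.choose (j + 1) * (j + 1) * t := by ring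
    _ = n.choose j * t * (n - j) := by rw [hch]; ring
    _ ≤ #O * (j + 1) * n := Nat.mul_le_mul key (Nat.sub_le _ _)
    _ = _ := by ring

theorem le_card_odd_of_odd (hk : 1 ≤ k) (hn : 1 ≤ n) (hodd : Odd k) (S : Finset (Fin n)) :
    (n.choose k : ℝ) * (1 - k * (n - #S) / n) ≤
      #{e ∈ powersetCard k (univ : Finset (Fin n)) | Odd #(e ∩ S)} := by
  have h1 := sum_card_inter_real hk hn Sᶜ
  have hs : #S ≤ n := by simpa using card_le_univ S
  have hc : ((#Sᶜ : ℕ) : ℝ) = n - #S := by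
    rw [card_compl, Fintype.card_fin, Nat.cast_sub hs]
  have h3 : ∑ e ∈ powersetCard k (univ : Finset (Fin n)), (1 - (#(e ∩ Sᶜ) : ℝ)) ≤
      #{e ∈ powersetCard k (univ : Finset (Fin n)) | Odd #(e ∩ S)} := by
    rw [card_filter]
    push_cast
    refine sum_le_sum fun e he => ?_
    rcases Nat.eq_zero_or_pos #(e ∩ Sᶜ) with h | h
    · have : e ∩ S = e := by
        rw [inter_eq_left]
        intro v hv
        by_contra hvS
        have : v ∈ e ∩ Sᶜ := by simp [hv, hvS]
        rw [card_eq_zero.1 h] at this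
        simp at this
      rw [this, (mem_powersetCard.1 he).2, if_pos hodd]
      simp
    · have h' : (1 : ℝ) ≤ #(e ∩ Sᶜ) := by exact_mod_cast h
      split_ifs <;> linarith
  rw [sum_sub_distrib, h1, hc] at h3
  simp only [sum_const, card_powersetCard, card_univ, Fintype.card_fin, nsmul_eq_mul] at h3
  calc _ = (n.choose k : ℝ) * 1 - n.choose k * (k * (n - #S) / n) := by ring
    _ ≤ _ := h3

theorem card_even_not_disjoint_le (hk : 2 ≤ k) (hn : 2 ≤ n) (S : Finset (Fin n)) :
    (#{e ∈ powersetCard k (univ : Finset (Fin n)) | Even #(e ∩ S) ∧ ¬ Disjoint e S} : ℝ) ≤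
      n.choose k * (k * #S / n) * ((k - 1) * #S / n) := by
  refine le_trans ?_ (sum_card_mul_pred_inter_le hk hn S)
  rw [card_filter]
  push_cast
  refine sum_le_sum fun e _ => ?_
  simp only [disjoint_iff_inter_eq_empty, ← card_eq_zero]
  generalize #(e ∩ S) = j
  match j with
  | 0 => simp
  | 1 => simp
  | j + 2 =>
    have : (if Even (j + 2) ∧ ¬ j + 2 = 0 then (1 : ℝ) else 0) ≤ 1 := by split_ifs <;> norm_num
    refine this.trans ?_
    push_cast
    nlinarith [(Nat.cast_nonneg j : (0 : ℝ) ≤ j)]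

/-! ### Vectors and their supports -/

/-- The set of coordinates at which a binary vector is `1`. -/
def ones (v : Fin n → ZMod 2) : Finset (Fin n) := {i | v i = 1}

theorem mem_ones {v : Fin n → ZMod 2} {i : Fin n} : i ∈ ones v ↔ v i = 1 := by simp [ones]

theorem zmod_two_eq (a : ZMod 2) : a = if a = 1 then 1 else 0 := by
  revert a; decide

theorem apply_eq_ite_mem_ones (v : Fin n → ZMod 2) (i : Fin n) :
    v i = if i ∈ ones v then 1 else 0 := by
  rw [zmod_two_eq (v i)]
  simp [mem_ones]

theorem ones_injective : Function.Injective (ones : (Fin n → ZMod 2) → Finset (Fin n)) := by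
  intro v w h
  ext i
  rw [apply_eq_ite_mem_ones v, apply_eq_ite_mem_ones w, h]

theorem ones_indicator (S : Finset (Fin n)) :
    ones (fun i => if i ∈ S then (1 : ZMod 2) else 0) = S := by
  ext i; simp [mem_ones]

theorem mem_Omega {v : Fin n → ZMod 2} : v ∈ Omega n k ↔ #(ones v) = k := by
  simp [Omega, ones]

theorem dotProduct_eq_zero_iff (x v : Fin n → ZMod 2) :
    x ⬝ᵥ v = 0 ↔ Even #(ones v ∩ ones x) := by
  rw [← ZMod.natCast_eq_zero_iff_even, dotProduct]
  have : ∑ i, x i * v i = ((#(ones v ∩ ones x) : ℕ) : ZMod 2) := by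
    rw [show ones v ∩ ones x = ({i | i ∈ ones v ∧ i ∈ ones x} : Finset (Fin n)) by ext; simp,
      card_filter]
    push_cast
    refine sum_congr rfl fun i _ => ?_
    rw [apply_eq_ite_mem_ones x i, apply_eq_ite_mem_ones v i]
    by_cases h1 : i ∈ ones v <;> by_cases h2 : i ∈ ones x <;> simp [h1, h2]
  rw [this]

theorem card_filter_Omega (p : Finset (Fin n) → Prop) [DecidablePred p] :
    #{v ∈ Omega n k | p (ones v)} = #{e ∈ powersetCard k (univ : Finset (Fin n)) | p e} := by
  refine card_bij (fun v _ => ones v) ?_ (fun v _ w _ h => ones_injective h) ?_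
  · intro v hv
    rw [mem_filter, mem_Omega] at hv
    simpa using hv
  · intro e he
    rw [mem_filter, mem_powersetCard] at he
    refine ⟨fun i => if i ∈ e then 1 else 0, ?_, ones_indicator e⟩
    rw [mem_filter, mem_Omega, ones_indicator]
    exact ⟨he.1.2, he.2⟩

theorem card_Omega : #(Omega n k) = n.choose k := by
  have := card_filter_Omega (n := n) (k := k) (fun _ => True)
  simpa using this

end

section

variable {n k m : ℕ}

/-! ### Rank deficiency as a parity condition -/

/-- The columns in `C` all have an even number of ones in the rows from `S`: the rows of the
matrix indexed by `S` add up to zero. -/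
def RowsSumZero (S : Finset (Fin n)) (C : Finset (Fin n → ZMod 2)) : Prop :=
  ∀ c ∈ C, Even #(ones c ∩ S)

/-- Some nonempty set of rows adds up to zero. If `k` is even, then the rows add up to zero in
any case, and the set of all rows is left out. -/
def Deficient (k : ℕ) (C : Finset (Fin n → ZMod 2)) : Prop :=
  ∃ S : Finset (Fin n), S.Nonempty ∧ (Even k → S ≠ univ) ∧ RowsSumZero S C

theorem Deficient.anti {C D : Finset (Fin n → ZMod 2)} (h : C ⊆ D) (hD : Deficient k D) :
    Deficient k C := by
  obtain ⟨S, h1, h2, h3⟩ := hD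
  exact ⟨S, h1, h2, fun c hc => h3 c (h hc)⟩

/-- The left kernel of the matrix with columns `C`. -/
noncomputable def leftKer (C : Finset (Fin n → ZMod 2)) : Submodule (ZMod 2) (Fin n → ZMod 2) :=
  LinearMap.ker (colMatrix C).transpose.mulVecLin

theorem mem_leftKer {C : Finset (Fin n → ZMod 2)} {x : Fin n → ZMod 2} :
    x ∈ leftKer C ↔ RowsSumZero (ones x) C := by
  rw [leftKer, LinearMap.mem_ker, Matrix.mulVecLin_apply, funext_iff]
  simp only [RowsSumZero, ← dotProduct_eq_zero_iff, Subtype.forall]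
  refine forall₂_congr fun c hc => ?_
  rw [dotProduct_comm]
  rfl

theorem rank_add_finrank_leftKer (C : Finset (Fin n → ZMod 2)) :
    (colMatrix C).rank + Module.finrank (ZMod 2) (leftKer C) = n := by
  rw [← Matrix.rank_transpose, Matrix.rank, leftKer,
    LinearMap.finrank_range_add_finrank_ker]
  simp

theorem deficient_iff_exists_mem_leftKer {C : Finset (Fin n → ZMod 2)} :
    Deficient k C ↔ ∃ x ∈ leftKer C, x ≠ 0 ∧ (Even k → x ≠ 1) := by
  have h0 : ∀ x : Fin n → ZMod 2, (ones x).Nonempty ↔ x ≠ 0 := by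
    intro x
    rw [nonempty_iff_ne_empty, ← (ones_injective (n := n)).ne_iff]
    simp [ones]
  have h1 : ∀ x : Fin n → ZMod 2, ones x ≠ univ ↔ x ≠ 1 := by
    intro x
    rw [← (ones_injective (n := n)).ne_iff]
    simp [ones]
  constructor
  · rintro ⟨S, hS, hS', hC⟩
    rw [← ones_indicator S] at hS hS' hC
    exact ⟨_, mem_leftKer.2 hC, (h0 _).1 hS, fun h => (h1 _).1 (hS' h)⟩
  · rintro ⟨x, hx, hx0, hx1⟩
    exact ⟨ones x, (h0 _).2 hx0, fun h => (h1 _).2 (hx1 h), mem_leftKer.1 hx⟩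

theorem rank_colMatrix_le_and_lt_iff (hn : 1 ≤ n) {C : Finset (Fin n → ZMod 2)}
    (hC : C ⊆ Omega n k) :
    (colMatrix C).rank ≤ nStar n k ∧ ((colMatrix C).rank < nStar n k ↔ Deficient k C) := by
  have hr := rank_add_finrank_leftKer C
  rw [deficient_iff_exists_mem_leftKer]
  unfold nStar
  by_cases hk : Even k
  · have h1 : (1 : Fin n → ZMod 2) ∈ leftKer C := by
      rw [mem_leftKer]
      intro c hc
      have : ones (1 : Fin n → ZMod 2) = univ := by simp [ones]
      rw [this, inter_univ, mem_Omega.1 (hC hc)]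
      exact hk
    have h10 : (1 : Fin n → ZMod 2) ≠ 0 := by
      intro h
      have := congrFun h ⟨0, hn⟩
      simp at this
    have hpos : 0 < Module.finrank (ZMod 2) (leftKer C) :=
      Module.finrank_pos_iff_exists_ne_zero.2 ⟨⟨1, h1⟩, by simpa [Subtype.ext_iff] using h10⟩
    have hone : Module.finrank (ZMod 2) (leftKer C) = 1 ↔
        ¬ ∃ x ∈ leftKer C, x ≠ 0 ∧ (Even k → x ≠ 1) := by
      rw [finrank_eq_one_iff_of_nonzero' (⟨1, h1⟩ : leftKer C)
        (by simpa [Subtype.ext_iff] using h10)]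
      constructor
      · rintro h ⟨x, hx, hx0, hx1⟩
        obtain ⟨a, ha⟩ := h ⟨x, hx⟩
        have ha : a • (1 : Fin n → ZMod 2) = x := congrArg Subtype.val ha
        rw [zmod_two_eq a] at ha
        split_ifs at ha
        · exact hx1 hk (by rw [← ha, one_smul])
        · exact hx0 (by rw [← ha, zero_smul])
      · rintro h ⟨x, hx⟩
        by_cases hx0 : x = 0
        · exact ⟨0, Subtype.ext (by simp [hx0])⟩
        · by_cases hx1 : x = 1
          · exact ⟨1, by simp [hx1]⟩
          · exact absurd ⟨x, hx, hx0, fun _ => hx1⟩ h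
    rw [if_pos hk, ← not_iff_not, ← hone]
    omega
  · have hzero : Module.finrank (ZMod 2) (leftKer C) = 0 ↔
        ¬ ∃ x ∈ leftKer C, x ≠ 0 ∧ (Even k → x ≠ 1) := by
      rw [Submodule.finrank_eq_zero, Submodule.eq_bot_iff]
      push Not
      exact forall₂_congr fun x _ => ⟨fun h h0 => absurd h h0, fun h => by
        by_contra h0
        exact hk (h h0).1⟩
    rw [if_neg hk, ← not_iff_not, ← hzero]
    omega

theorem probRank_eq (P : ℕ → Prop) :
    probRank n m k P = subsetProb (Omega n k) m (fun C => P (colMatrix C).rank) := rfl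

theorem probRank_lt_nStar (hn : 1 ≤ n) :
    probRank n m k (fun r => r < nStar n k) = subsetProb (Omega n k) m (Deficient k) := by
  rw [probRank_eq]
  exact subsetProb_congr fun C hC =>
    (rank_colMatrix_le_and_lt_iff hn (mem_powersetCard.1 hC).1).2

theorem probRank_eq_nStar (hn : 1 ≤ n) :
    probRank n m k (fun r => r = nStar n k) =
      subsetProb (Omega n k) m (fun C => ¬ Deficient k C) := by
  rw [probRank_eq]
  refine subsetProb_congr fun C hC => ?_
  have h := rank_colMatrix_le_and_lt_iff hn (mem_powersetCard.1 hC).1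
  rw [← h.2]
  omega

theorem probRank_eq_nStar_mono (hn : 1 ≤ n) {m' : ℕ} (h : m ≤ m') (hm' : m' ≤ n.choose k) :
    probRank n m k (fun r => r = nStar n k) ≤ probRank n m' k (fun r => r = nStar n k) := by
  rw [probRank_eq_nStar hn, probRank_eq_nStar hn]
  exact subsetProb_mono_card (fun C D hCD hC hD => hC (hD.anti hCD)) h (by rwa [card_Omega])

/-- If `k` is even, then complementing a set of rows does not affect whether it adds up to zero;
so only sets of at most half of the rows matter. -/
theorem Deficient.exists_small_or_odd {C : Finset (Fin n → ZMod 2)} (hC : C ⊆ Omega n k)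
    (h : Deficient k C) :
    ∃ S : Finset (Fin n), S.Nonempty ∧ (2 * #S ≤ n ∨ Odd k) ∧ RowsSumZero S C := by
  obtain ⟨S, h1, h2, h3⟩ := h
  rcases Nat.even_or_odd k with hk | hk
  · by_cases hS : 2 * #S ≤ n
    · exact ⟨S, h1, Or.inl hS, h3⟩
    · refine ⟨Sᶜ, ?_, Or.inl ?_, fun c hc => ?_⟩
      · rw [nonempty_iff_ne_empty, Ne, compl_eq_empty_iff]
        exact h2 hk
      · rw [card_compl, Fintype.card_fin]; omega
      · have e1 : #(ones c ∩ S) + #(ones c ∩ Sᶜ) = k := by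
          rw [← mem_Omega.1 (hC hc), ← card_union_of_disjoint, ← inter_union_distrib_left]
          · simp
          · exact disjoint_compl_right.mono inter_subset_right inter_subset_right
        have e2 := h3 c hc
        rw [← e1] at hk
        exact (Nat.even_add.1 hk).1 e2
  · exact ⟨S, h1, Or.inr hk, h3⟩

/-- Some row is zero. -/
def HasZeroRow (C : Finset (Fin n → ZMod 2)) : Prop := ∃ i : Fin n, ∀ c ∈ C, i ∉ ones c

theorem HasZeroRow.deficient (hn : 2 ≤ n) {C : Finset (Fin n → ZMod 2)} (h : HasZeroRow C) :
    Deficient k C := by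
  obtain ⟨i, hi⟩ := h
  refine ⟨{i}, singleton_nonempty i, fun _ h => ?_, fun c hc => ?_⟩
  · have := congrArg card h
    simp at this
    omega
  · rw [inter_singleton_of_notMem (hi c hc)]
    simp

/-! ### Bounds for the probability that a set of rows adds up to zero -/

theorem rowsSumZero_iff_subset {S : Finset (Fin n)} {C : Finset (Fin n → ZMod 2)}
    (hC : C ⊆ Omega n k) :
    RowsSumZero S C ↔ C ⊆ {v ∈ Omega n k | Even #(ones v ∩ S)} := by
  simp only [RowsSumZero, subset_iff, mem_filter]
  exact ⟨fun h c hc => ⟨hC hc, h c hc⟩, fun h c hc => (h hc).2⟩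

theorem card_even_add_card_odd (S : Finset (Fin n)) :
    (#{v ∈ Omega n k | Even #(ones v ∩ S)} : ℝ) +
      #{e ∈ powersetCard k (univ : Finset (Fin n)) | Odd #(e ∩ S)} = n.choose k := by
  rw [card_filter_Omega (fun e => Even #(e ∩ S))]
  have := card_filter_add_card_filter_not (s := powersetCard k (univ : Finset (Fin n)))
    (fun e => Even #(e ∩ S))
  simp only [Nat.not_even_iff_odd, card_powersetCard, card_univ, Fintype.card_fin] at this
  exact_mod_cast this

theorem card_even_div_le {S : Finset (Fin n)} {q : ℝ} (hkn : k ≤ n)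
    (hq : (n.choose k : ℝ) * q ≤
      #{e ∈ powersetCard k (univ : Finset (Fin n)) | Odd #(e ∩ S)}) (j : ℕ) :
    ((#{v ∈ Omega n k | Even #(ones v ∩ S)} : ℝ) / #(Omega n k)) ^ j ≤ Real.exp (-(q * j)) := by
  have hN : (0 : ℝ) < n.choose k := by exact_mod_cast Nat.choose_pos hkn
  have h := card_even_add_card_odd (k := k) S
  have h1 : (#{v ∈ Omega n k | Even #(ones v ∩ S)} : ℝ) / #(Omega n k) ≤ Real.exp (-q) := by
    rw [card_Omega, div_le_iff₀ hN]
    calc (#{v ∈ Omega n k | Even #(ones v ∩ S)} : ℝ) ≤ (1 - q) * n.choose k := by linarith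
      _ ≤ _ := by
        gcongr
        linarith [Real.add_one_le_exp (-q)]
  calc _ ≤ Real.exp (-q) ^ j := by gcongr
    _ = _ := by rw [← Real.exp_nat_mul]; congr 1; ring

/-- If at least a fraction `q` of the `k`-sets meets `S` in an odd number of points, then the rows
in `S` add up to zero with probability at most `exp (- q m)`. -/
theorem subsetProb_rowsSumZero_le {S : Finset (Fin n)} {q : ℝ} (hkn : k ≤ n)
    (hq : (n.choose k : ℝ) * q ≤
      #{e ∈ powersetCard k (univ : Finset (Fin n)) | Odd #(e ∩ S)}) :
    subsetProb (Omega n k) m (RowsSumZero S) ≤ Real.exp (-(q * m)) := by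
  refine le_trans ?_ (card_even_div_le hkn hq m)
  rw [subsetProb_congr fun C hC => rowsSumZero_iff_subset (mem_powersetCard.1 hC).1]
  exact subsetProb_subset_le (filter_subset _ _) m

/-- If no row is zero, then a set `S` of rows can only add up to zero if some column has at least
two ones in `S`, which for small `S` is unlikely. -/
theorem subsetProb_rowsSumZero_not_hasZeroRow_le {S : Finset (Fin n)} {q : ℝ} (hk : 2 ≤ k)
    (hkn : k ≤ n) (hm : m ≤ n.choose k) (hS : S.Nonempty)
    (hq : (n.choose k : ℝ) * q ≤
      #{e ∈ powersetCard k (univ : Finset (Fin n)) | Odd #(e ∩ S)}) :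
    subsetProb (Omega n k) m (fun C => RowsSumZero S C ∧ ¬ HasZeroRow C) ≤
      (k * #S / n) ^ 2 * m * Real.exp (-(q * (m - 1 : ℕ))) := by
  classical
  have hN : (0 : ℝ) < n.choose k := by exact_mod_cast Nat.choose_pos hkn
  set F := {v ∈ Omega n k | Even #(ones v ∩ S)} with hF
  set G := {v ∈ Omega n k | Disjoint (ones v) S} with hG
  have hFG : (#(F \ G) : ℝ) ≤ n.choose k * (k * #S / n) ^ 2 := by
    have h1 : F \ G = {v ∈ Omega n k | Even #(ones v ∩ S) ∧ ¬ Disjoint (ones v) S} := by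
      ext v
      simp only [hF, hG, Finset.mem_sdiff, mem_filter]
      tauto
    rw [h1, card_filter_Omega (fun e => Even #(e ∩ S) ∧ ¬ Disjoint e S)]
    refine (card_even_not_disjoint_le hk (by omega) S).trans ?_
    rw [pow_two, ← mul_assoc]
    gcongr
    linarith
  calc subsetProb (Omega n k) m (fun C => RowsSumZero S C ∧ ¬ HasZeroRow C)
      ≤ subsetProb (Omega n k) m (fun C => C ⊆ F ∧ ¬ C ⊆ G) := by
        refine subsetProb_mono fun C hC h =>
          ⟨(rowsSumZero_iff_subset (mem_powersetCard.1 hC).1).1 h.1, fun hCG => h.2 ?_⟩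
        obtain ⟨i, hi⟩ := hS
        exact ⟨i, fun c hc hic =>
          disjoint_left.1 (mem_filter.1 (hCG hc)).2 hic hi⟩
    _ ≤ (#(F \ G) : ℝ) * (m / #(Omega n k)) * ((#F : ℝ) / #(Omega n k)) ^ (m - 1) :=
        subsetProb_subset_not_subset_le (filter_subset _ _) G (by rwa [card_Omega])
    _ ≤ (n.choose k * (k * #S / n) ^ 2) * (m / n.choose k) * Real.exp (-(q * (m - 1 : ℕ))) := by
        rw [card_Omega]
        gcongr
        have := card_even_div_le hkn hq (m - 1)
        rwa [card_Omega] at this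
    _ = _ := by field_simp

/-! ### Small and large sets of rows -/

theorem small_card_odd (hk : 2 ≤ k) (hn : 2 ≤ n) {S : Finset (Fin n)} :
    (n.choose k : ℝ) * (k * #S / n * (1 - k * #S / n)) ≤
      #{e ∈ powersetCard k (univ : Finset (Fin n)) | Odd #(e ∩ S)} := by
  refine le_trans ?_ (le_card_odd_of_moments hk hn S)
  rw [← mul_assoc]
  gcongr
  linarith

/-- If neither `S` nor its complement is small, then the last point of a `k`-set can be chosen to
make the intersection odd. If only few points are missing from `S` and `k` is odd, then most
`k`-sets lie in `S` and so meet it in an odd number `k` of points. -/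
theorem large_card_odd (hk : 2 ≤ k) (hn : 8 * k ^ 2 ≤ n) {S : Finset (Fin n)}
    (hS : n < 4 * k * #S) (hodd : 2 * #S ≤ n ∨ Odd k) :
    (n.choose k : ℝ) * (1 / (8 * k)) ≤
      #{e ∈ powersetCard k (univ : Finset (Fin n)) | Odd #(e ∩ S)} := by
  have hkn : k ≤ n := by nlinarith
  have hn0 : 0 < n := by omega
  have hs : #S ≤ n := by simpa using card_le_univ S
  by_cases hc : n ≤ 4 * k * (n - #S)
  · -- Neither `S` nor its complement is small, so that the last point of a `k`-set can be chosen
    -- in at least `t ≥ n / (8 k)` ways.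
    set t := min #S (n - #S) - (k - 1) with ht
    have hmin : n ≤ 4 * k * min #S (n - #S) := by
      rcases le_total #S (n - #S) with h | h
      · rw [min_eq_left h]; exact hS.le
      · rw [min_eq_right h]; exact hc
    have hmk : k ≤ min #S (n - #S) := by
      by_contra hlt
      push Not at hlt
      have : 4 * k * min #S (n - #S) ≤ 4 * k * k := by gcongr
      nlinarith
    have key := choose_mul_le_card_odd_mul (t := t) (by omega) hkn S (by omega) (by omega)
    have htn : n ≤ 8 * k * t := by
      have h1 : min #S (n - #S) ≤ t + k := by omega
      have h2 : 4 * k * min #S (n - #S) ≤ 4 * k * (t + k) := by gcongr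
      nlinarith
    have keyR : (n.choose k : ℝ) * t ≤
      #{e ∈ powersetCard k (univ : Finset (Fin n)) | Odd #(e ∩ S)} * n := by exact_mod_cast key
    have htR : (n : ℝ) ≤ 8 * k * t := by exact_mod_cast htn
    have hnR : (0 : ℝ) < n := by exact_mod_cast hn0
    refine le_of_mul_le_mul_right (le_trans ?_ keyR) hnR
    rw [mul_assoc]
    gcongr
    rw [div_mul_eq_mul_div, one_mul, div_le_iff₀ (by positivity)]
    linarith
  · -- The complement of `S` is small, which excludes the first alternative of `hodd`.
    push Not at hc
    have hoddk : Odd k := by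
      rcases hodd with h | h
      · exfalso
        have : n ≤ 2 * (n - #S) := by omega
        nlinarith
      · exact h
    refine le_trans ?_ (le_card_odd_of_odd (by omega) hn0 hoddk S)
    gcongr
    have hnR : (0 : ℝ) < n := by exact_mod_cast hn0
    have hcR : (4 : ℝ) * k * (n - #S) < n := by
      rw [← Nat.cast_sub hs]; exact_mod_cast hc
    have hk2 : (2 : ℝ) ≤ k := by exact_mod_cast hk
    have h1 : (k : ℝ) * (n - #S) / n ≤ 1 / 4 := by
      rw [div_le_iff₀ hnR]; linarith
    have h2 : 1 / (8 * (k : ℝ)) ≤ 1 / 16 := by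
      gcongr; linarith
    linarith

theorem sum_powerset_large_le (hk : 2 ≤ k) (hn : 8 * k ^ 2 ≤ n) :
    ∑ S : Finset (Fin n) with n < 4 * k * #S ∧ (2 * #S ≤ n ∨ Odd k),
      subsetProb (Omega n k) m (RowsSumZero S) ≤ 2 ^ n * Real.exp (-(1 / (8 * k) * m)) := by
  have hkn : k ≤ n := by nlinarith
  calc _ ≤ ∑ S : Finset (Fin n) with n < 4 * k * #S ∧ (2 * #S ≤ n ∨ Odd k),
        Real.exp (-(1 / (8 * k) * m)) := by
        refine sum_le_sum fun S hS => ?_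
        rw [mem_filter] at hS
        exact subsetProb_rowsSumZero_le hkn (large_card_odd hk hn hS.2.1 hS.2.2)
    _ = #{S : Finset (Fin n) | n < 4 * k * #S ∧ (2 * #S ≤ n ∨ Odd k)} *
        Real.exp (-(1 / (8 * k) * m)) := by rw [sum_const, nsmul_eq_mul]
    _ ≤ _ := by
        gcongr
        have := card_filter_le (univ : Finset (Finset (Fin n)))
          (fun S => n < 4 * k * #S ∧ (2 * #S ≤ n ∨ Odd k))
        rw [card_univ, Fintype.card_finset, Fintype.card_fin] at this
        exact_mod_cast this

/-- Union bound for a rank deficiency together with an event `R`: the sets with more than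
`n / (4 k)` elements contribute little, for want of more than `2 ^ n` of them. -/
theorem subsetProb_deficient_and_le (hk : 2 ≤ k) (hn : 8 * k ^ 2 ≤ n)
    (R : Finset (Fin n → ZMod 2) → Prop) :
    subsetProb (Omega n k) m (fun C => Deficient k C ∧ R C) ≤
      ∑ S : Finset (Fin n) with S.Nonempty ∧ 4 * k * #S ≤ n,
        subsetProb (Omega n k) m (fun C => RowsSumZero S C ∧ R C) +
      2 ^ n * Real.exp (-(1 / (8 * k) * m)) := by
  refine le_trans ?_ (add_le_add_right (sum_powerset_large_le hk hn) _)
  refine le_trans ?_ (add_le_add (subsetProb_exists_le _ _ _ _) (subsetProb_exists_le _ _ _ _))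
  refine le_trans (subsetProb_mono ?_) (subsetProb_or_le _ _ _ _)
  rintro C hC ⟨hD, hR⟩
  obtain ⟨S, h1, h2, h3⟩ := hD.exists_small_or_odd (mem_powersetCard.1 hC).1
  rcases le_or_gt (4 * k * #S) n with h | h
  · exact Or.inl ⟨S, by simp [h1, h], h3, hR⟩
  · exact Or.inr ⟨S, by rw [mem_filter]; exact ⟨mem_univ _, h, h2⟩, h3⟩

theorem sum_small_eq (f : ℕ → ℝ) :
    ∑ S : Finset (Fin n) with S.Nonempty ∧ 4 * k * #S ≤ n, f #S =
      ∑ s ∈ range (n + 1) with 1 ≤ s ∧ 4 * k * s ≤ n, n.choose s * f s := by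
  rw [sum_filter, sum_filter, ← powerset_univ]
  have := sum_powerset_apply_card (fun s => if 1 ≤ s ∧ 4 * k * s ≤ n then f s else 0)
    (x := (univ : Finset (Fin n)))
  simp only [card_univ, Fintype.card_fin] at this
  simp only [← card_pos, Nat.lt_iff_add_one_le, zero_add] at *
  rw [this]
  refine sum_congr rfl fun s _ => ?_
  rw [nsmul_eq_mul]
  split_ifs <;> simp

end

/-! ### Many columns -/

theorem eventually_two_pow_mul_exp_le {k : ℕ} (hk : 1 ≤ k) {δ : ℝ} (hδ : 0 < δ) {m : ℕ → ℕ}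
    (hm : ∀ᶠ n : ℕ in atTop, δ * n * Real.log n ≤ m n) :
    ∀ᶠ n : ℕ in atTop, (2 : ℝ) ^ n * Real.exp (-(1 / (8 * k) * m n)) ≤ Real.exp (-1 * n) := by
  have hlog : Tendsto (fun n : ℕ => Real.log n) atTop atTop :=
    Real.tendsto_log_atTop.comp tendsto_natCast_atTop_atTop
  filter_upwards [hm, hlog.eventually_ge_atTop (8 * k * (1 + Real.log 2) / δ)] with n hn hl
  have hkR : (0 : ℝ) < k := by exact_mod_cast hk
  rw [div_le_iff₀ hδ] at hl
  have h2 : (2 : ℝ) ^ n = Real.exp (n * Real.log 2) := by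
    rw [Real.exp_nat_mul, Real.exp_log two_pos]
  rw [h2, ← Real.exp_add]
  gcongr
  have h3 : (n : ℝ) * (8 * k * (1 + Real.log 2)) ≤ m n := by
    calc (n : ℝ) * (8 * k * (1 + Real.log 2)) ≤ n * (Real.log n * δ) := by gcongr
      _ = δ * n * Real.log n := by ring
      _ ≤ m n := hn
  have h4 : (n : ℝ) * (1 + Real.log 2) ≤ 1 / (8 * k) * m n := by
    rw [div_mul_eq_mul_div, one_mul, le_div_iff₀ (by positivity)]
    linarith
  linarith

theorem sum_small_rowsSumZero_le {n k m : ℕ} (hk : 2 ≤ k) (hn : 8 * k ^ 2 ≤ n) {b : ℝ}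
    (hb : 1 ≤ b) (hm : (b + 1) * n * Real.log n ≤ m) :
    ∑ S : Finset (Fin n) with S.Nonempty ∧ 4 * k * #S ≤ n,
        subsetProb (Omega n k) m (RowsSumZero S) ≤ 2 * (n : ℝ) ^ (-(b - 1)) := by
  have hkn : k ≤ n := by nlinarith
  have hn1 : 1 ≤ n := by omega
  have hn0 : (0 : ℝ) < n := by exact_mod_cast hn1
  calc ∑ S : Finset (Fin n) with S.Nonempty ∧ 4 * k * #S ≤ n,
        subsetProb (Omega n k) m (RowsSumZero S)
      ≤ ∑ S : Finset (Fin n) with S.Nonempty ∧ 4 * k * #S ≤ n,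
          Real.exp (-((#S : ℝ) / n * m)) := by
        refine sum_le_sum fun S hS => subsetProb_rowsSumZero_le hkn ?_
        refine le_trans ?_ (small_card_odd hk (by omega))
        rw [mem_filter] at hS
        have h1 : (4 * k * #S : ℝ) ≤ n := by exact_mod_cast hS.2.2
        have h2 : (k * #S : ℝ) / n ≤ 1 / 4 := by
          rw [div_le_iff₀ hn0]; linarith
        have h3 : (2 : ℝ) * (#S / n) ≤ k * #S / n := by
          rw [mul_div_assoc]
          gcongr
          exact_mod_cast hk
        have h4 : (0 : ℝ) ≤ #S / n := by positivity
        gcongr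
        nlinarith
    _ = ∑ s ∈ range (n + 1) with 1 ≤ s ∧ 4 * k * s ≤ n,
          n.choose s * Real.exp (-((s : ℝ) / n * m)) :=
        sum_small_eq (fun s => Real.exp (-((s : ℝ) / n * m)))
    _ ≤ ∑ s ∈ range (n + 1) with 1 ≤ s ∧ 4 * k * s ≤ n, (n : ℝ) ^ (-b) := by
        refine sum_le_sum fun s hs => ?_
        have hs1 : (1 : ℝ) ≤ s := by exact_mod_cast (mem_filter.1 hs).2.1
        have hl : 0 ≤ Real.log n := Real.log_nonneg (by exact_mod_cast hn1)
        calc (n.choose s : ℝ) * Real.exp (-((s : ℝ) / n * m))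
            ≤ (n : ℝ) ^ s * Real.exp (-((s : ℝ) / n * m)) := by
              gcongr
              exact_mod_cast Nat.choose_le_pow n s
          _ = Real.exp (s * Real.log n - (s : ℝ) / n * m) := by
              rw [sub_eq_add_neg, Real.exp_add, Real.exp_nat_mul, Real.exp_log hn0]
          _ ≤ Real.exp (Real.log n * -b) := by
              gcongr
              have : (s : ℝ) / n * ((b + 1) * n * Real.log n) ≤ (s : ℝ) / n * m := by gcongr
              have h2 : (s : ℝ) / n * ((b + 1) * n * Real.log n) = s * (b + 1) * Real.log n := by
                field_simp
              have h3 : 0 ≤ (s - 1) * (b * Real.log n) :=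
                mul_nonneg (by linarith) (mul_nonneg (by linarith) hl)
              nlinarith
          _ = _ := (Real.rpow_def_of_pos hn0 _).symm
    _ ≤ (n + 1) * (n : ℝ) ^ (-b) := by
        rw [sum_const, nsmul_eq_mul]
        gcongr
        have := card_filter_le (range (n + 1)) (fun s => 1 ≤ s ∧ 4 * k * s ≤ n)
        rw [card_range] at this
        exact_mod_cast this
    _ ≤ (2 * n) * (n : ℝ) ^ (-b) := by
        gcongr
        have : (1 : ℝ) ≤ n := by exact_mod_cast hn1
        linarith
    _ = _ := by
        rw [mul_assoc, show -(b - 1) = 1 + -b by ring, Real.rpow_add hn0, Real.rpow_one]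

theorem probRank_lt_isLittleO {A : ℝ} (hA : 0 < A) {k : ℕ} (hk : 3 ≤ k) {m : ℕ → ℕ}
    (hm : ∀ᶠ n : ℕ in atTop, (A + 3) * n * Real.log n ≤ m n) :
    (fun n : ℕ => probRank n (m n) k (fun r => r < nStar n k))
      =o[atTop] (fun n : ℕ => (n : ℝ) ^ (-A)) := by
  have hbound : ∀ᶠ n : ℕ in atTop, probRank n (m n) k (fun r => r < nStar n k) ≤
      2 * (n : ℝ) ^ (-(A + 1)) + Real.exp (-1 * n) := by
    filter_upwards [hm, eventually_ge_atTop (8 * k ^ 2),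
      eventually_two_pow_mul_exp_le (by omega : 1 ≤ k) (by linarith : 0 < A + 3) hm]
      with n h1 h2 h3
    have hn : 1 ≤ n := by nlinarith
    rw [probRank_lt_nStar hn]
    have h4 := subsetProb_deficient_and_le (m := m n) (by omega : 2 ≤ k) h2 (fun _ => True)
    simp only [and_true] at h4
    have h5 := sum_small_rowsSumZero_le (m := m n) (by omega : 2 ≤ k) h2 (b := A + 2)
      (by linarith) (by convert h1 using 3; ring)
    rw [show -(A + 2 - 1) = -(A + 1) by ring] at h5
    linarith
  have h1 : (fun n : ℕ => Real.exp (-1 * n)) =o[atTop] (fun n : ℕ => (n : ℝ) ^ (-A)) :=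
    (isLittleO_exp_neg_mul_rpow_atTop one_pos (-A)).comp_tendsto tendsto_natCast_atTop_atTop
  have h2 : (fun n : ℕ => 2 * (n : ℝ) ^ (-(A + 1))) =o[atTop] (fun n : ℕ => (n : ℝ) ^ (-A)) := by
    refine IsLittleO.const_mul_left ?_ 2
    have h := ((isLittleO_one_iff ℝ).2 tendsto_inv_atTop_nhds_zero_nat).mul_isBigO
      (isBigO_refl (fun n : ℕ => (n : ℝ) ^ (-A)) atTop)
    refine h.congr' ?_ (by simp)
    filter_upwards [eventually_ge_atTop 1] with n hn
    have hn0 : (0 : ℝ) < n := by exact_mod_cast hn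
    rw [show -(A + 1) = -1 + -A by ring, Real.rpow_add hn0, Real.rpow_neg_one]
  refine IsBigO.trans_isLittleO ?_ (h2.add h1)
  refine IsBigO.of_bound 1 ?_
  filter_upwards [hbound] with n hn
  have h0 : 0 ≤ probRank n (m n) k (fun r => r < nStar n k) := subsetProb_nonneg _ _ _
  rw [one_mul, Real.norm_of_nonneg h0, Real.norm_of_nonneg (by positivity)]
  exact hn

/-! ### Zero rows -/

theorem card_filter_disjoint {n k : ℕ} (t : Finset (Fin n)) :
    #{v ∈ Omega n k | Disjoint (ones v) t} = (n - #t).choose k := by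
  rw [card_filter_Omega (fun e => Disjoint e t)]
  have : {e ∈ powersetCard k (univ : Finset (Fin n)) | Disjoint e t} = powersetCard k tᶜ := by
    ext e
    simp only [mem_filter, mem_powersetCard, subset_univ, true_and, subset_compl_iff_disjoint_right]
    tauto
  rw [this, card_powersetCard, card_compl, Fintype.card_fin]

/-- The probability that `s` given rows are all zero: the `m` columns are then chosen among the
`k`-subsets of the other `n - s` rows. -/
noncomputable def zeroRowsProb (n k m s : ℕ) : ℝ :=
  (((n - s).choose k).choose m : ℝ) / (n.choose k).choose m

theorem subsetProb_zeroRows {n k m : ℕ} (t : Finset (Fin n)) :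
    subsetProb (Omega n k) m (fun C => ∀ i ∈ t, ∀ c ∈ C, i ∉ ones c) =
      zeroRowsProb n k m #t := by
  rw [zeroRowsProb, ← card_filter_disjoint t, ← card_Omega (n := n), ← subsetProb_subset (filter_subset _ _)]
  refine subsetProb_congr fun C hC => ?_
  have hC := (mem_powersetCard.1 hC).1
  simp only [subset_iff, mem_filter, disjoint_left]
  exact ⟨fun h c hc => ⟨hC hc, fun i hi hit => h i hit c hc hi⟩,
    fun h i hi c hc hic => (h hc).2 hic hi⟩

theorem subsetProb_not_hasZeroRow (n k m : ℕ) :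
    subsetProb (Omega n k) m (fun C => ¬ HasZeroRow C) =
      ∑ s ∈ range (n + 1), (-1) ^ s * (n.choose s * zeroRowsProb n k m s) := by
  classical
  -- Inclusion-exclusion over all sets of vectors, weighted by the indicator of the `m`-subsets of
  -- `Omega n k`.
  have key := inclusion_exclusion_sum_inf_compl (univ : Finset (Fin n))
    (fun i => ({C | ∀ c ∈ C, i ∉ ones c} : Finset (Finset (Fin n → ZMod 2))))
    (fun C => if C ∈ (Omega n k).powersetCard m then (1 : ℝ) else 0)
  have hL : ∀ (Q : Finset (Fin n → ZMod 2) → Prop) (I : Finset (Finset (Fin n → ZMod 2))),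
      (∀ C, C ∈ I ↔ Q C) →
      (∑ C ∈ I, if C ∈ (Omega n k).powersetCard m then (1 : ℝ) else 0) =
        subsetProb (Omega n k) m Q * (#(Omega n k)).choose m := by
    intro Q I hI
    have : (∑ C ∈ I, if C ∈ (Omega n k).powersetCard m then (1 : ℝ) else 0) =
        #{C ∈ (Omega n k).powersetCard m | Q C} := by
      rw [← sum_filter, sum_const, nsmul_eq_mul, mul_one]
      congr 2
      ext C
      simp only [mem_filter, hI]
      tauto
    rw [this, subsetProb_eq]
    rcases Nat.eq_zero_or_pos ((#(Omega n k)).choose m) with h0 | h0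
    · rw [h0]
      have h1 : #{C ∈ (Omega n k).powersetCard m | Q C} ≤ #((Omega n k).powersetCard m) :=
        card_filter_le _ _
      rw [card_powersetCard, h0] at h1
      simp [Nat.le_zero.1 h1]
    · rw [div_mul_cancel₀]
      exact_mod_cast h0.ne'
  rw [hL (fun C => ¬ HasZeroRow C) _ (by intro C; simp [mem_inf, HasZeroRow])] at key
  have hR : ∀ t ∈ (univ : Finset (Fin n)).powerset,
      ((-1 : ℤ) ^ #t • ∑ C ∈ t.inf
        (fun i => ({C | ∀ c ∈ C, i ∉ ones c} : Finset (Finset (Fin n → ZMod 2)))),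
        if C ∈ (Omega n k).powersetCard m then (1 : ℝ) else 0) =
      ((-1) ^ #t * zeroRowsProb n k m #t) * (#(Omega n k)).choose m := by
    intro t _
    rw [hL (fun C => ∀ i ∈ t, ∀ c ∈ C, i ∉ ones c) _ (by intro C; simp [mem_inf]),
      subsetProb_zeroRows, zsmul_eq_mul]
    push_cast
    ring
  rw [sum_congr rfl hR, ← Finset.sum_mul] at key
  have hsum := sum_powerset_apply_card (fun s => (-1 : ℝ) ^ s * zeroRowsProb n k m s)
    (x := (univ : Finset (Fin n)))
  rw [hsum] at key
  simp only [card_univ, Fintype.card_fin, nsmul_eq_mul] at key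
  rcases Nat.eq_zero_or_pos ((#(Omega n k)).choose m) with h0 | h0
  · -- Too many columns are asked for: both sides are zero, as quotients with denominator zero.
    rw [subsetProb_eq, h0]
    rw [card_Omega] at h0
    simp [zeroRowsProb, h0]
  · have h0' : ((#(Omega n k)).choose m : ℝ) ≠ 0 := by exact_mod_cast h0.ne'
    rw [mul_right_cancel₀ h0' key]
    exact sum_congr rfl fun s _ => by ring

theorem zeroRowsProb_le {n k m s : ℕ} (hn : 1 ≤ n) (hsn : s ≤ n) :
    zeroRowsProb n k m s ≤ Real.exp (-((k : ℝ) * m / n)) ^ s := by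
  have hn0 : (0 : ℝ) < n := by exact_mod_cast hn
  have h1 : ((n - s).choose k : ℝ) / n.choose k ≤ Real.exp (-((k : ℝ) * s / n)) := by
    calc ((n - s).choose k : ℝ) / n.choose k ≤ (((n - s : ℕ) : ℝ) / n) ^ k :=
          choose_div_choose_le_pow (Nat.sub_le _ _) k
      _ ≤ Real.exp (-((s : ℝ) / n)) ^ k := by
          gcongr
          rw [Nat.cast_sub hsn, sub_div, div_self hn0.ne']
          linarith [Real.add_one_le_exp (-((s : ℝ) / n))]
      _ = _ := by rw [← Real.exp_nat_mul]; congr 1; ring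
  calc zeroRowsProb n k m s ≤ (((n - s).choose k : ℝ) / n.choose k) ^ m :=
        choose_div_choose_le_pow (Nat.choose_le_choose k (Nat.sub_le _ _)) m
    _ ≤ Real.exp (-((k : ℝ) * s / n)) ^ m := by gcongr
    _ = _ := by
        rw [← Real.exp_nat_mul, ← Real.exp_nat_mul]; congr 1; ring

theorem choose_mul_le_choose_sub {n k s : ℕ} (hk : 1 ≤ k) (hn : 1 ≤ n) (hsn : s ≤ n) :
    (n.choose k : ℝ) * (1 - k * s / n) ≤ (n - s).choose k := by
  obtain ⟨t, -, ht⟩ := exists_subset_card_eq (s := (univ : Finset (Fin n))) (n := s) (by simpa)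
  have h1 := sum_card_inter_real hk hn t
  have h3 : ∑ e ∈ powersetCard k (univ : Finset (Fin n)), (1 - (#(e ∩ t) : ℝ)) ≤
      #{e ∈ powersetCard k (univ : Finset (Fin n)) | Disjoint e t} := by
    rw [card_filter]
    push_cast
    refine sum_le_sum fun e he => ?_
    simp only [disjoint_iff_inter_eq_empty, ← card_eq_zero]
    rcases Nat.eq_zero_or_pos #(e ∩ t) with h | h
    · simp [h]
    · have h' : (1 : ℝ) ≤ #(e ∩ t) := by exact_mod_cast h
      split_ifs <;> linarith
  rw [← card_filter_Omega (fun e => Disjoint e t), card_filter_disjoint, sum_sub_distrib, h1,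
    ht] at h3
  simp only [sum_const, card_powersetCard, card_univ, Fintype.card_fin, nsmul_eq_mul] at h3
  linarith

theorem le_zeroRowsProb {n k m s : ℕ} (hk : 1 ≤ k) (hn : 2 ≤ n) (hkn : k ≤ n)
    (hks : 4 * (k * s) ≤ n) (hm : m * n ≤ n.choose k) :
    Real.exp (-((k : ℝ) * m / n * (1 + 4 * (1 + k * s) / n))) ^ s ≤ zeroRowsProb n k m s := by
  have hs : s ≤ n := by nlinarith
  have hN : 0 < n.choose k := Nat.choose_pos hkn
  have hM := choose_mul_le_choose_sub hk (by omega) hs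
  unfold zeroRowsProb
  have hMN : (n - s).choose k ≤ n.choose k := Nat.choose_le_choose k (Nat.sub_le _ _)
  set N := n.choose k
  set M := (n - s).choose k
  set a : ℝ := k * s with ha
  have ha0 : 0 ≤ a := by positivity
  have hn2 : (2 : ℝ) ≤ n := by exact_mod_cast hn
  have han : 4 * a ≤ n := by rw [ha]; exact_mod_cast hks
  have hNR : (0 : ℝ) < N := by exact_mod_cast hN
  have hmR : (m : ℝ) * n ≤ N := by exact_mod_cast hm
  have hm0 : (0 : ℝ) ≤ m := by positivity
  have han' : a / n ≤ 1 / 4 := by rw [div_le_iff₀ (by linarith)]; linarith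
  have hmM : m ≤ M := by
    have : (m : ℝ) ≤ M := by nlinarith
    exact_mod_cast this
  have hmN : m < N := by
    have : (m : ℝ) < N := by nlinarith
    exact_mod_cast this
  have hmN' : (0 : ℝ) < N - m := by
    have : (m : ℝ) < N := by exact_mod_cast hmN
    linarith
  have hd : 0 < (n : ℝ) - 1 - a := by linarith
  have hx : 1 - a / (n - 1) ≤ 1 - ((N : ℝ) - M) / (N - m) := by
    have : ((N : ℝ) - M) / (N - m) ≤ a / (n - 1) := by
      rw [div_le_div_iff₀ hmN' (by linarith)]
      have h1 : (N : ℝ) - M ≤ N * (a / n) := by linarith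
      have h2 : (N : ℝ) * (n - 1) ≤ n * (N - m) := by linarith
      calc ((N : ℝ) - M) * (n - 1) ≤ N * (a / n) * (n - 1) := by
            gcongr
            linarith
        _ = a / n * (N * (n - 1)) := by ring
        _ ≤ a / n * (n * (N - m)) := by gcongr
        _ = a * (N - m) := by field_simp
    linarith
  -- `1 - y = 1 / (1 + y / (1 - y))` turns the lower bound into an exponential.
  have hy : Real.exp (-(a / (n - 1 - a))) ≤ 1 - a / (n - 1) := by
    have h1 : 1 - a / ((n : ℝ) - 1) = (1 + a / (n - 1 - a))⁻¹ := by
      have : (n : ℝ) - 1 ≠ 0 := by linarith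
      field_simp
      ring
    rw [h1, Real.exp_neg]
    gcongr
    linarith [Real.add_one_le_exp (a / ((n : ℝ) - 1 - a))]
  have hfrac : a / ((n : ℝ) - 1 - a) ≤ a / n * (1 + 4 * (1 + a) / n) := by
    rw [div_mul_eq_mul_div, div_le_div_iff₀ hd (by linarith)]
    have h4 : (n : ℝ) ≤ 4 * (n - 1 - a) := by linarith
    have h5 : 1 + a ≤ (1 + a) / n * (4 * (n - 1 - a)) := by
      rw [div_mul_eq_mul_div, le_div_iff₀ (by linarith)]
      gcongr
    have h6 : (n : ℝ) ≤ (1 + 4 * (1 + a) / n) * (n - 1 - a) := by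
      have : (1 + 4 * (1 + a) / n) * (n - 1 - a) =
        (n - 1 - a) + (1 + a) / n * (4 * (n - 1 - a)) := by ring
      linarith
    calc a * n ≤ a * ((1 + 4 * (1 + a) / n) * (n - 1 - a)) := by gcongr
      _ = _ := by ring
  calc Real.exp (-((k : ℝ) * m / n * (1 + 4 * (1 + a) / n))) ^ s
      = Real.exp (-(a / n * (1 + 4 * (1 + a) / n))) ^ m := by
        rw [← Real.exp_nat_mul, ← Real.exp_nat_mul, ha]; congr 1; ring
    _ ≤ Real.exp (-(a / (n - 1 - a))) ^ m := by gcongr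
    _ ≤ (1 - ((N : ℝ) - M) / (N - m)) ^ m := by
        gcongr
        exact hy.trans hx
    _ ≤ _ := pow_le_choose_div_choose hMN hmM hmN

/-! ### The critical window -/

theorem tendsto_log_add_div {c : ℕ → ℝ} {c₀ : ℝ} (hc : Tendsto c atTop (𝓝 c₀)) :
    Tendsto (fun n : ℕ => (Real.log n + c n) / n) atTop (𝓝 0) := by
  have h1 : Tendsto (fun n : ℕ => Real.log n / n) atTop (𝓝 0) :=
    (Real.isLittleO_log_id_atTop.tendsto_div_nhds_zero).comp tendsto_natCast_atTop_atTop
  have h2 : Tendsto (fun n : ℕ => c n / n) atTop (𝓝 0) :=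
    hc.div_atTop tendsto_natCast_atTop_atTop
  simpa [add_div] using h1.add h2

theorem mul_div_eq_of_eq_mul_div {k n m c L : ℝ} (hk : k ≠ 0) (hn : n ≠ 0)
    (hm : m = n * (L + c) / k) : k * m / n = L + c := by
  rw [hm]; field_simp

/-- In the critical window `m` is much smaller than the number of possible columns. -/
theorem eventually_mul_le_choose {k : ℕ} (hk : 3 ≤ k) {m : ℕ → ℕ} {c : ℕ → ℝ} {c₀ : ℝ}
    (hc : Tendsto c atTop (𝓝 c₀))
    (hm : ∀ᶠ n : ℕ in atTop, (m n : ℝ) ≤ n * (Real.log n + c n) / k) :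
    ∀ᶠ n : ℕ in atTop, m n * n ≤ n.choose k := by
  have hkR : (0 : ℝ) < k := by positivity
  have hδ : (0 : ℝ) < 1 / (2 ^ k * k.factorial) := by positivity
  filter_upwards [hm, (tendsto_log_add_div hc).eventually_le_const hδ,
    eventually_ge_atTop (2 * k)] with n h1 h2 h3
  have hn0 : (0 : ℝ) < n := by exact_mod_cast (by omega : 0 < n)
  have hn1 : (1 : ℝ) ≤ n := by exact_mod_cast (by omega : 1 ≤ n)
  rw [div_le_iff₀ hn0] at h2
  have h4 : (m n : ℝ) * n ≤ n.choose k := by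
    calc (m n : ℝ) * n ≤ n * (Real.log n + c n) / k * n := by gcongr
      _ ≤ n * (1 / (2 ^ k * k.factorial) * n) / k * n := by gcongr
      _ ≤ n * (1 / (2 ^ k * k.factorial) * n) / 1 * n := by
          gcongr
          exact_mod_cast (by omega : 1 ≤ k)
      _ = (n : ℝ) ^ 3 / (2 ^ k * k.factorial) := by field_simp
      _ ≤ (n : ℝ) ^ k / (2 ^ k * k.factorial) := by gcongr
      _ = ((n : ℝ) / 2) ^ k / k.factorial := by rw [div_pow, div_div]
      _ ≤ ((n + 1 - k : ℕ) : ℝ) ^ k / k.factorial := by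
          gcongr
          rw [Nat.cast_sub (by omega)]
          have : (2 : ℝ) * k ≤ n := by exact_mod_cast h3
          push_cast
          linarith
      _ ≤ _ := Nat.pow_le_choose k n
  exact_mod_cast h4

theorem tendsto_choose_mul_exp_pow {l : ℕ → ℝ} {c₀ : ℝ}
    (hl : Tendsto (fun n : ℕ => l n - Real.log n) atTop (𝓝 c₀)) (s : ℕ) :
    Tendsto (fun n : ℕ => (n.choose s : ℝ) * Real.exp (-l n) ^ s) atTop
      (𝓝 (Real.exp (-c₀) ^ s / s.factorial)) := by
  refine ProbabilityTheory.tendsto_choose_mul_pow_atTop s ?_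
  have : Tendsto (fun n : ℕ => Real.exp (-(l n - Real.log n))) atTop (𝓝 (Real.exp (-c₀))) :=
    (Real.continuous_exp.tendsto _).comp hl.neg
  refine this.congr' ?_
  filter_upwards [eventually_ge_atTop 1] with n hn
  have hn0 : (0 : ℝ) < n := by exact_mod_cast hn
  rw [neg_sub, sub_eq_add_neg, Real.exp_add, Real.exp_log hn0]

theorem tendsto_choose_mul_zeroRowsProb {k : ℕ} (hk : 3 ≤ k) {m : ℕ → ℕ} {c : ℕ → ℝ} {c₀ : ℝ}
    (hc : Tendsto c atTop (𝓝 c₀))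
    (hm : ∀ᶠ n : ℕ in atTop, (m n : ℝ) = n * (Real.log n + c n) / k) (s : ℕ) :
    Tendsto (fun n : ℕ => (n.choose s : ℝ) * zeroRowsProb n k (m n) s) atTop
      (𝓝 (Real.exp (-c₀) ^ s / s.factorial)) := by
  have hkR : (k : ℝ) ≠ 0 := by positivity
  have hkm : ∀ᶠ n : ℕ in atTop, (k : ℝ) * m n / n = Real.log n + c n := by
    filter_upwards [hm, eventually_ge_atTop 1] with n h1 h2
    exact mul_div_eq_of_eq_mul_div hkR (by positivity) h1
  have hup : Tendsto (fun n : ℕ => ((k : ℝ) * m n / n) - Real.log n) atTop (𝓝 c₀) := by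
    refine hc.congr' ?_
    filter_upwards [hkm] with n hn
    rw [hn]; ring
  have hlow : Tendsto (fun n : ℕ => ((k : ℝ) * m n / n * (1 + 4 * (1 + k * s) / n)) - Real.log n)
      atTop (𝓝 c₀) := by
    have h := hc.add ((tendsto_log_add_div hc).const_mul (4 * (1 + (k : ℝ) * s)))
    rw [mul_zero, add_zero] at h
    refine h.congr' ?_
    filter_upwards [hkm] with n hn
    rw [hn]; ring
  refine tendsto_of_tendsto_of_tendsto_of_le_of_le' (tendsto_choose_mul_exp_pow hlow s)
    (tendsto_choose_mul_exp_pow hup s) ?_ ?_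
  · filter_upwards [eventually_mul_le_choose hk hc (hm.mono fun n h => h.le),
      eventually_ge_atTop (4 * (k * s)), eventually_ge_atTop k] with n h1 h2 h3
    gcongr
    exact le_zeroRowsProb (by omega) (by omega) h3 h2 h1
  · filter_upwards [eventually_ge_atTop s, eventually_ge_atTop 1] with n h1 h2
    gcongr
    exact zeroRowsProb_le h2 h1

/-- The limit is the probability that a Poisson variable of mean `exp (- c₀)` is zero. As the
terms of the inclusion-exclusion formula for the absence of zero rows are dominated by the
exponential series, the limit can be taken term by term. -/
theorem tendsto_subsetProb_not_hasZeroRow {k : ℕ} (hk : 3 ≤ k) {m : ℕ → ℕ} {c : ℕ → ℝ} {c₀ : ℝ}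
    (hc : Tendsto c atTop (𝓝 c₀))
    (hm : ∀ᶠ n : ℕ in atTop, (m n : ℝ) = n * (Real.log n + c n) / k) :
    Tendsto (fun n : ℕ => subsetProb (Omega n k) (m n) (fun C => ¬ HasZeroRow C)) atTop
      (𝓝 (Real.exp (-Real.exp (-c₀)))) := by
  have hkR : (k : ℝ) ≠ 0 := by positivity
  have hexp : Real.exp (-Real.exp (-c₀)) =
      ∑' s : ℕ, (-1) ^ s * (Real.exp (-c₀) ^ s / s.factorial) := by
    rw [Real.exp_eq_exp_ℝ, congrFun (NormedSpace.exp_eq_tsum_div (𝔸 := ℝ)) (-_)]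
    refine tsum_congr fun s => ?_
    rw [neg_pow, mul_div_assoc]
  have hsum : ∀ n : ℕ, subsetProb (Omega n k) (m n) (fun C => ¬ HasZeroRow C) =
      ∑' s : ℕ, (-1) ^ s * (n.choose s * zeroRowsProb n k (m n) s) := by
    intro n
    rw [subsetProb_not_hasZeroRow, tsum_eq_sum]
    intro s hs
    rw [Nat.choose_eq_zero_of_lt (by simpa using hs)]
    simp
  simp_rw [hsum]
  rw [hexp]
  refine tendsto_tsum_of_dominated_convergence
    (bound := fun s : ℕ => Real.exp (-(c₀ - 1)) ^ s / s.factorial)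
    (Real.summable_pow_div_factorial _)
    (fun s => (tendsto_choose_mul_zeroRowsProb hk hc hm s).const_mul _) ?_
  filter_upwards [hm, eventually_ge_atTop 1, hc.eventually_const_le (by linarith : c₀ - 1 < c₀)]
    with n h1 h2 h3 s
  have hn0 : (0 : ℝ) < n := by exact_mod_cast h2
  have hz : 0 ≤ zeroRowsProb n k (m n) s := by unfold zeroRowsProb; positivity
  rw [norm_mul, norm_pow, norm_neg, norm_one, one_pow, one_mul, Real.norm_of_nonneg (by positivity)]
  rcases lt_or_ge n s with h | h
  · rw [Nat.choose_eq_zero_of_lt h, Nat.cast_zero, zero_mul]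
    positivity
  calc (n.choose s : ℝ) * zeroRowsProb n k (m n) s
      ≤ ((n : ℝ) ^ s / s.factorial) * Real.exp (-((k : ℝ) * m n / n)) ^ s := by
        gcongr
        · exact Nat.choose_le_pow_div s n
        · exact zeroRowsProb_le h2 h
    _ = (n * Real.exp (-((k : ℝ) * m n / n))) ^ s / s.factorial := by rw [mul_pow]; ring
    _ = Real.exp (-c n) ^ s / s.factorial := by
        rw [mul_div_eq_of_eq_mul_div hkR hn0.ne' h1, neg_add, Real.exp_add, Real.exp_neg,
          Real.exp_log hn0, mul_inv_cancel_left₀ hn0.ne']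
    _ ≤ _ := by gcongr

theorem summable_sq_mul_pow_div_sqrt_factorial {D : ℝ} (hD : 0 ≤ D) :
    Summable (fun s : ℕ => (s : ℝ) ^ 2 * (D ^ s / √(s.factorial : ℝ))) := by
  have h1 : Summable (fun s : ℕ => ((1 / 4 : ℝ)) ^ s + ((8 * D) ^ 2) ^ s / s.factorial) :=
    (summable_geometric_of_lt_one (by norm_num) (by norm_num)).add
      (Real.summable_pow_div_factorial _)
  refine Summable.of_nonneg_of_le (fun s => by positivity) (fun s => ?_) h1
  have hs : (s : ℝ) ^ 2 ≤ 4 ^ s := by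
    have : (s : ℝ) ≤ 2 ^ s := by exact_mod_cast Nat.lt_two_pow_self.le
    calc (s : ℝ) ^ 2 ≤ (2 ^ s) ^ 2 := by gcongr
      _ = 4 ^ s := by rw [← pow_mul, mul_comm, pow_mul]; norm_num
  have e1 : ((1 / 2 : ℝ) ^ s) ^ 2 = (1 / 4) ^ s := by
    rw [← pow_mul, mul_comm, pow_mul]; norm_num
  have e2 : ((8 * D) ^ s / √(s.factorial : ℝ)) ^ 2 = ((8 * D) ^ 2) ^ s / s.factorial := by
    rw [div_pow, Real.sq_sqrt (by positivity), ← pow_mul, ← pow_mul, mul_comm s 2]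
  rw [← e1, ← e2]
  calc (s : ℝ) ^ 2 * (D ^ s / √(s.factorial : ℝ)) ≤ 4 ^ s * (D ^ s / √(s.factorial : ℝ)) := by
        gcongr
    _ = (1 / 2 : ℝ) ^ s * ((8 * D) ^ s / √(s.factorial : ℝ)) := by
        have : (4 : ℝ) ^ s = (1 / 2) ^ s * 8 ^ s := by rw [← mul_pow]; norm_num
        rw [this, mul_pow]; ring
    -- By the inequality `a b ≤ a² + b²`.
    _ ≤ _ := by nlinarith [sq_nonneg ((1 / 2 : ℝ) ^ s), sq_nonneg ((8 * D) ^ s / √(s.factorial : ℝ)),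
                  sq_nonneg ((1 / 2 : ℝ) ^ s - (8 * D) ^ s / √(s.factorial : ℝ))]

/-- The left side bounds the expected number of `s`-sets of rows that add up to zero in a matrix
with `m - 1` columns. Its main factors `n ^ s` and `exp (- s log n)` cancel. The correction
`exp (s (k s / n) log n)` is at most `√(4 k s) ^ s`, because `log x / x` is decreasing and
`4 k s ≤ n`, and is absorbed by half of the factorial. -/
theorem choose_mul_exp_le {n k m s : ℕ} {B : ℝ} (hk : 1 ≤ k) (hB : 0 ≤ B) (hs : 1 ≤ s)
    (hks : 4 * k * s ≤ n) (hm : Real.log n - B ≤ k * (m - 1 : ℕ) / n) :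
    (n.choose s : ℝ) * Real.exp (-((k * s / n * (1 - k * s / n)) * (m - 1 : ℕ))) ≤
      (Real.exp B * √(4 * k * Real.exp 1)) ^ s / √(s.factorial : ℝ) := by
  have hs0 : (0 : ℝ) < s := by exact_mod_cast hs
  have hk1 : (1 : ℝ) ≤ k := by exact_mod_cast hk
  have hxn : (4 : ℝ) * k * s ≤ n := by exact_mod_cast hks
  have hx4 : (4 : ℝ) ≤ 4 * k * s := by
    have : (1 : ℝ) ≤ s := by exact_mod_cast hs
    nlinarith
  have hn0 : (0 : ℝ) < n := by linarith
  have hL : 0 ≤ Real.log n := Real.log_nonneg (by linarith)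
  have he : Real.exp 1 ≤ 4 * k * s := by linarith [Real.exp_one_lt_d9]
  have hlog : k * s / n * Real.log n ≤ Real.log √(4 * k * s) := by
    have h1 : Real.log n / n ≤ Real.log (4 * k * s) / (4 * k * s) :=
      Real.log_div_self_antitoneOn he (he.trans hxn) hxn
    rw [Real.log_sqrt (by positivity)]
    have h2 : 0 ≤ Real.log (4 * k * s) := Real.log_nonneg (by linarith)
    calc k * s / n * Real.log n = (k * s) * (Real.log n / n) := by ring
      _ ≤ (k * s) * (Real.log (4 * k * s) / (4 * k * s)) := by gcongr
      _ = Real.log (4 * k * s) / 4 := by field_simp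
      _ ≤ _ := by linarith
  have ha : 0 ≤ 1 - k * s / (n : ℝ) := by
    have : k * s / (n : ℝ) ≤ 1 := by
      rw [div_le_iff₀ hn0]; linarith
    linarith
  have hexp : -((k * s / n * (1 - k * s / n)) * ((m - 1 : ℕ) : ℝ)) ≤
      s * (-Real.log n + (B + Real.log √(4 * k * s))) := by
    have h1 : (1 - k * s / (n : ℝ)) * (Real.log n - B) ≤
        (1 - k * s / n) * (k * (m - 1 : ℕ) / n) := by gcongr
    have h2 : 0 ≤ k * s / (n : ℝ) * B := by positivity
    calc -((k * s / n * (1 - k * s / n)) * ((m - 1 : ℕ) : ℝ))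
        = s * -((1 - k * s / n) * (k * (m - 1 : ℕ) / n)) := by ring
      _ ≤ _ := by
        gcongr
        linarith
  have hpow : √(s : ℝ) ^ s ≤ √(Real.exp 1) ^ s * √(s.factorial : ℝ) := by
    have h := Real.pow_div_factorial_le_exp _ hs0.le s
    rw [div_le_iff₀ (by positivity)] at h
    have e : ∀ x : ℝ, 0 ≤ x → (√x ^ s) ^ 2 = x ^ s := fun x hx => by
      rw [← pow_mul, mul_comm s 2, pow_mul, Real.sq_sqrt hx]
    refine (pow_le_pow_iff_left₀ (by positivity) (by positivity) two_ne_zero).1 ?_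
    rw [mul_pow, e _ hs0.le, e _ (Real.exp_pos 1).le, Real.sq_sqrt (by positivity),
      ← Real.exp_nat_mul, mul_one]
    exact h
  have hsf : 0 < √(s.factorial : ℝ) := by positivity
  have hsq : √(s.factorial : ℝ) * √(s.factorial : ℝ) = s.factorial :=
    Real.mul_self_sqrt (by positivity)
  calc (n.choose s : ℝ) * Real.exp (-((k * s / n * (1 - k * s / n)) * (m - 1 : ℕ)))
      ≤ ((n : ℝ) ^ s / s.factorial) *
          Real.exp (s * (-Real.log n + (B + Real.log √(4 * k * s)))) := by
        gcongr
        exact Nat.choose_le_pow_div s n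
    _ = (Real.exp B * √(4 * k)) ^ s * √(s : ℝ) ^ s / s.factorial := by
        rw [Real.exp_nat_mul, Real.exp_add, Real.exp_add, Real.exp_log (by positivity),
          Real.exp_neg, Real.exp_log hn0, mul_pow, inv_pow, mul_pow, mul_pow,
          Real.sqrt_mul (by positivity) (s : ℝ), mul_pow]
        field_simp
    _ ≤ (Real.exp B * √(4 * k)) ^ s * (√(Real.exp 1) ^ s * √(s.factorial : ℝ)) /
          s.factorial := by gcongr
    _ = _ := by
        rw [Real.sqrt_mul (by positivity) (Real.exp 1), ← mul_assoc (Real.exp B), mul_pow _ √_,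
          ← mul_assoc, div_eq_div_iff (by positivity) hsf.ne', mul_assoc, hsq]
        ring

/-- In the critical window, zero rows are asymptotically the only obstruction to full rank. -/
theorem tendsto_subsetProb_deficient_not_hasZeroRow {k : ℕ} (hk : 3 ≤ k) {m : ℕ → ℕ}
    {c : ℕ → ℝ} {c₀ : ℝ} (hc : Tendsto c atTop (𝓝 c₀))
    (hm : ∀ᶠ n : ℕ in atTop, (m n : ℝ) = n * (Real.log n + c n) / k) :
    Tendsto (fun n : ℕ => subsetProb (Omega n k) (m n)
      (fun C => Deficient k C ∧ ¬ HasZeroRow C)) atTop (𝓝 0) := by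
  have hk0 : (0 : ℝ) < k := by positivity
  set B : ℝ := |c₀ - 1| + 1 with hB
  have hB0 : 0 ≤ B := by positivity
  set D : ℝ := Real.exp B * √(4 * k * Real.exp 1) with hD
  have hD0 : 0 ≤ D := by positivity
  have hsum := summable_sq_mul_pow_div_sqrt_factorial hD0
  set T : ℝ := ∑' s : ℕ, (s : ℝ) ^ 2 * (D ^ s / √(s.factorial : ℝ)) with hT
  have hlogT : Tendsto (fun n : ℕ => Real.log n) atTop atTop :=
    Real.tendsto_log_atTop.comp tendsto_natCast_atTop_atTop
  have hc1 : ∀ᶠ n in atTop, c₀ - 1 ≤ c n :=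
    hc.eventually_const_le (by linarith : c₀ - 1 < c₀)
  have hmlarge : ∀ᶠ n : ℕ in atTop, 1 / (2 * k) * n * Real.log n ≤ m n := by
    filter_upwards [hm, hc1, hlogT.eventually_ge_atTop (2 * B)] with n h1 h2 h3
    rw [h1]
    have : -|c₀ - 1| ≤ c₀ - 1 := neg_abs_le _
    calc 1 / (2 * k) * n * Real.log n = n * (Real.log n / 2) / k := by ring
      _ ≤ _ := by
        gcongr
        linarith
  have hlim : Tendsto (fun n : ℕ => k * ((Real.log n + c n) / n) * T + Real.exp (-1 * n)) atTop
      (𝓝 0) := by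
    have h1 := ((tendsto_log_add_div hc).const_mul (k : ℝ)).mul_const T
    have h2 : Tendsto (fun n : ℕ => Real.exp (-1 * n)) atTop (𝓝 0) := by
      simp only [neg_one_mul]
      exact Real.tendsto_exp_neg_atTop_nhds_zero.comp tendsto_natCast_atTop_atTop
    simpa using h1.add h2
  refine squeeze_zero' (Eventually.of_forall fun n => subsetProb_nonneg _ _ _) ?_ hlim
  filter_upwards [hm, hc1, eventually_mul_le_choose hk hc (hm.mono fun n h => h.le),
    eventually_ge_atTop (8 * k ^ 2),
    eventually_two_pow_mul_exp_le (by omega : 1 ≤ k) (by positivity) hmlarge]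
    with n h1 h2 h3 h4 h5
  have hkn : k ≤ n := by nlinarith
  have hn0 : (0 : ℝ) < n := by exact_mod_cast (by omega : 0 < n)
  refine (subsetProb_deficient_and_le (by omega) h4 _).trans (add_le_add ?_ h5)
  have hkm := mul_div_eq_of_eq_mul_div hk0.ne' hn0.ne' h1
  have hm1 : Real.log n - B ≤ k * (m n - 1 : ℕ) / n := by
    have e1 : (m n : ℝ) - 1 ≤ (m n - 1 : ℕ) := by
      rw [sub_le_iff_le_add]
      exact_mod_cast Nat.le_succ_of_pred_le le_rfl
    have e2 : (k : ℝ) / n ≤ 1 := by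
      rw [div_le_one hn0]; exact_mod_cast hkn
    have e3 : -|c₀ - 1| ≤ c₀ - 1 := neg_abs_le _
    calc Real.log n - B ≤ k * m n / n - k / n := by rw [hkm]; linarith
      _ = k * (m n - 1) / n := by ring
      _ ≤ _ := by gcongr
  have hmn : m n ≤ n.choose k := by
    refine le_trans ?_ h3
    exact Nat.le_mul_of_pos_right _ (by omega)
  calc ∑ S : Finset (Fin n) with S.Nonempty ∧ 4 * k * #S ≤ n,
        subsetProb (Omega n k) (m n) (fun C => RowsSumZero S C ∧ ¬ HasZeroRow C)
      ≤ ∑ S : Finset (Fin n) with S.Nonempty ∧ 4 * k * #S ≤ n,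
          (k * #S / n) ^ 2 * m n *
            Real.exp (-((k * #S / n * (1 - k * #S / n)) * (m n - 1 : ℕ))) := by
        refine sum_le_sum fun S hS => ?_
        rw [mem_filter] at hS
        exact subsetProb_rowsSumZero_not_hasZeroRow_le (by omega) hkn hmn hS.2.1
          (small_card_odd (by omega) (by omega))
    _ = ∑ s ∈ range (n + 1) with 1 ≤ s ∧ 4 * k * s ≤ n,
          n.choose s * ((k * s / n) ^ 2 * m n *
            Real.exp (-((k * s / n * (1 - k * s / n)) * (m n - 1 : ℕ)))) :=
        sum_small_eq (fun s => (k * s / n) ^ 2 * m n *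
          Real.exp (-((k * s / n * (1 - k * s / n)) * (m n - 1 : ℕ))))
    _ ≤ ∑ s ∈ range (n + 1) with 1 ≤ s ∧ 4 * k * s ≤ n,
          k * ((Real.log n + c n) / n) * ((s : ℝ) ^ 2 * (D ^ s / √(s.factorial : ℝ))) := by
        refine sum_le_sum fun s hs => ?_
        rw [mem_filter] at hs
        rw [← hkm]
        calc (n.choose s : ℝ) * ((k * s / n) ^ 2 * m n *
              Real.exp (-((k * s / n * (1 - k * s / n)) * (m n - 1 : ℕ))))
            = (k * (k * m n / n / n) * (s : ℝ) ^ 2) * (n.choose s *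
              Real.exp (-((k * s / n * (1 - k * s / n)) * (m n - 1 : ℕ)))) := by ring
          _ ≤ (k * (k * m n / n / n) * (s : ℝ) ^ 2) * (D ^ s / √(s.factorial : ℝ)) := by
            gcongr
            exact choose_mul_exp_le (by omega) hB0 hs.2.1 hs.2.2 hm1
          _ = _ := by ring
    _ = k * ((Real.log n + c n) / n) * ∑ s ∈ range (n + 1) with 1 ≤ s ∧ 4 * k * s ≤ n,
          ((s : ℝ) ^ 2 * (D ^ s / √(s.factorial : ℝ))) := by rw [mul_sum]
    _ ≤ k * ((Real.log n + c n) / n) * T := by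
        rw [← hkm]
        gcongr
        exact hsum.sum_le_tsum _ fun s _ => by positivity

theorem tendsto_probRank_eq_nStar {k : ℕ} (hk : 3 ≤ k) {m : ℕ → ℕ} {c : ℕ → ℝ} {c₀ : ℝ}
    (hc : Tendsto c atTop (𝓝 c₀))
    (hm : ∀ᶠ n : ℕ in atTop, (m n : ℝ) = n * (Real.log n + c n) / k) :
    Tendsto (fun n : ℕ => probRank n (m n) k (fun r => r = nStar n k)) atTop
      (𝓝 (Real.exp (-Real.exp (-c₀)))) := by
  have h1 := tendsto_subsetProb_not_hasZeroRow hk hc hm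
  have h2 := h1.sub (tendsto_subsetProb_deficient_not_hasZeroRow hk hc hm)
  rw [sub_zero] at h2
  refine tendsto_of_tendsto_of_tendsto_of_le_of_le' h2 h1 ?_ ?_
  · filter_upwards [eventually_ge_atTop 1] with n hn
    rw [probRank_eq_nStar hn, sub_le_iff_le_add]
    refine le_trans (subsetProb_mono fun C _ hC => ?_) (subsetProb_or_le _ _ _ _)
    by_cases hD : Deficient k C
    · exact Or.inr ⟨hD, hC⟩
    · exact Or.inl hD
  · filter_upwards [eventually_ge_atTop 2] with n hn
    rw [probRank_eq_nStar (by omega)]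
    exact subsetProb_mono fun C _ hC hz => hC (hz.deficient hn)

/-! ### Outside the critical window -/

/-- The number of columns that corresponds to the value `C` of the parameter `c`, up to
rounding. -/
noncomputable def windowSize (k : ℕ) (C : ℝ) (n : ℕ) : ℕ := ⌊n * (Real.log n + C) / k⌋₊

theorem tendsto_probRank_windowSize {k : ℕ} (hk : 3 ≤ k) (C : ℝ) :
    Tendsto (fun n : ℕ => probRank n (windowSize k C n) k (fun r => r = nStar n k)) atTop
      (𝓝 (Real.exp (-Real.exp (-C)))) := by
  have hk0 : (0 : ℝ) < k := by positivity
  have hlogT : Tendsto (fun n : ℕ => Real.log n) atTop atTop :=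
    Real.tendsto_log_atTop.comp tendsto_natCast_atTop_atTop
  have hlow : Tendsto (fun n : ℕ => C - k / n) atTop (𝓝 C) := by
    simpa using (tendsto_const_nhds (x := C)).sub (tendsto_const_div_atTop_nhds_zero_nat (k : ℝ))
  refine tendsto_probRank_eq_nStar hk (c := fun n => k * windowSize k C n / n - Real.log n)
    (tendsto_of_tendsto_of_tendsto_of_le_of_le' hlow tendsto_const_nhds ?_ ?_) ?_
  · filter_upwards [eventually_ge_atTop 1] with n hn
    have hn0 : (0 : ℝ) < n := by exact_mod_cast hn
    have h := (Nat.lt_floor_add_one (n * (Real.log n + C) / k)).le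
    rw [← windowSize, div_le_iff₀ hk0] at h
    have : Real.log n + C ≤ k * windowSize k C n / n + k / n := by
      rw [← add_div, le_div_iff₀ hn0]; linarith
    linarith
  · filter_upwards [eventually_ge_atTop 1, hlogT.eventually_ge_atTop (-C)] with n hn hl
    have hn0 : (0 : ℝ) < n := by exact_mod_cast hn
    have hl' : 0 ≤ Real.log n + C := by linarith
    have h : (windowSize k C n : ℝ) ≤ n * (Real.log n + C) / k := Nat.floor_le (by positivity)
    rw [le_div_iff₀ hk0] at h
    have : k * windowSize k C n / n ≤ Real.log n + C := by
      rw [div_le_iff₀ hn0]; linarith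
    linarith
  · filter_upwards [eventually_ge_atTop 1] with n hn
    have hn0 : (0 : ℝ) < n := by exact_mod_cast hn
    field_simp
    ring

theorem probRank_le_one (n m k : ℕ) (P : ℕ → Prop) : probRank n m k P ≤ 1 := by
  classical
  rw [probRank_eq, subsetProb_eq, ← card_powersetCard]
  exact div_le_one_of_le₀ (by exact_mod_cast card_filter_le _ _) (by positivity)

theorem tendsto_probRank_eq_nStar_of_atTop {k : ℕ} (hk : 3 ≤ k) {m : ℕ → ℕ} {c : ℕ → ℝ}
    (hm : ∀ᶠ n : ℕ in atTop, (m n : ℝ) = n * (Real.log n + c n) / k ∧ m n ≤ n.choose k)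
    (hc : Tendsto c atTop atTop) :
    Tendsto (fun n : ℕ => probRank n (m n) k (fun r => r = nStar n k)) atTop (𝓝 1) := by
  have hlim : Tendsto (fun C : ℝ => Real.exp (-Real.exp (-C))) atTop (𝓝 1) := by
    have := (Real.continuous_exp.tendsto _).comp Real.tendsto_exp_neg_atTop_nhds_zero.neg
    simpa [Function.comp_def] using this
  refine tendsto_order.2 ⟨fun a ha => ?_, fun a ha =>
    Eventually.of_forall fun n => (probRank_le_one _ _ _ _).trans_lt ha⟩
  obtain ⟨C, hC⟩ := (hlim.eventually_const_lt ha).exists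
  filter_upwards [(tendsto_probRank_windowSize hk C).eventually_const_lt hC, hm,
    hc.eventually_ge_atTop C, eventually_ge_atTop 1] with n h1 h2 h3 h4
  refine h1.trans_le (probRank_eq_nStar_mono h4 ?_ h2.2)
  rw [windowSize]
  refine Nat.floor_le_of_le ?_
  rw [h2.1]
  gcongr

theorem tendsto_probRank_eq_nStar_of_atBot {k : ℕ} (hk : 3 ≤ k) {m : ℕ → ℕ} {c : ℕ → ℝ}
    (hm : ∀ᶠ n : ℕ in atTop, (m n : ℝ) = n * (Real.log n + c n) / k ∧ m n ≤ n.choose k)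
    (hc : Tendsto c atTop atBot) :
    Tendsto (fun n : ℕ => probRank n (m n) k (fun r => r = nStar n k)) atTop (𝓝 0) := by
  have hlim : Tendsto (fun C : ℝ => Real.exp (-Real.exp (-C))) atBot (𝓝 0) :=
    Real.tendsto_exp_neg_atTop_nhds_zero.comp (Real.tendsto_exp_atTop.comp tendsto_neg_atBot_atTop)
  have hlogT : Tendsto (fun n : ℕ => Real.log n) atTop atTop :=
    Real.tendsto_log_atTop.comp tendsto_natCast_atTop_atTop
  refine tendsto_order.2 ⟨fun a ha => Eventually.of_forall fun n =>
    ha.trans_le (subsetProb_nonneg _ _ _), fun a ha => ?_⟩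
  obtain ⟨C, hC⟩ := (hlim.eventually_lt_const ha).exists
  have hw : ∀ᶠ n : ℕ in atTop, (windowSize k C n : ℝ) ≤ n * (Real.log n + C) / k := by
    filter_upwards [hlogT.eventually_ge_atTop (-C)] with n hl
    have hl' : 0 ≤ Real.log n + C := by linarith
    exact Nat.floor_le (by positivity)
  filter_upwards [(tendsto_probRank_windowSize hk C).eventually_lt_const hC, hm,
    hc.eventually_le_atBot C, eventually_ge_atTop 1,
    eventually_mul_le_choose hk (tendsto_const_nhds (x := C)) hw] with n h1 h2 h3 h4 h5
  refine (probRank_eq_nStar_mono h4 ?_ ((Nat.le_mul_of_pos_right _ h4).trans h5)).trans_lt h1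
  rw [windowSize]
  refine Nat.le_floor ?_
  rw [h2.1]
  gcongr

end RandomBinaryMatrix

theorem theorem2 :
    (∀ A : ℝ, 0 < A → ∃ γ : ℝ, 0 < γ ∧ ∀ k : ℕ, 3 ≤ k → ∀ m : ℕ → ℕ,
      (∀ᶠ n : ℕ in atTop,
        γ * (n : ℝ) * Real.log (n : ℝ) ≤ (m n : ℝ) ∧ m n ≤ n.choose k) →
      (fun n : ℕ => RandomBinaryMatrix.probRank n (m n) k
          (fun r => r < RandomBinaryMatrix.nStar n k))
        =o[atTop] (fun n : ℕ => (n : ℝ) ^ (-A))) ∧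
    (∀ k : ℕ, 3 ≤ k → ∀ (m : ℕ → ℕ) (c : ℕ → ℝ),
      (∀ᶠ n : ℕ in atTop,
        (m n : ℝ) = (n : ℝ) * (Real.log (n : ℝ) + c n) / (k : ℝ) ∧ m n ≤ n.choose k) →
      (Tendsto c atTop atBot →
        Tendsto (fun n : ℕ => RandomBinaryMatrix.probRank n (m n) k
          (fun r => r = RandomBinaryMatrix.nStar n k)) atTop (𝓝 0)) ∧
      (∀ c₀ : ℝ, Tendsto c atTop (𝓝 c₀) →
        Tendsto (fun n : ℕ => RandomBinaryMatrix.probRank n (m n) k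
          (fun r => r = RandomBinaryMatrix.nStar n k)) atTop
          (𝓝 (Real.exp (-Real.exp (-c₀))))) ∧
      (Tendsto c atTop atTop →
        Tendsto (fun n : ℕ => RandomBinaryMatrix.probRank n (m n) k
          (fun r => r = RandomBinaryMatrix.nStar n k)) atTop (𝓝 1))) := by
  refine ⟨fun A hA => ⟨A + 3, by linarith, fun k hk m hm =>
    RandomBinaryMatrix.probRank_lt_isLittleO hA hk (hm.mono fun n h => h.1)⟩,
    fun k hk m c hm => ⟨RandomBinaryMatrix.tendsto_probRank_eq_nStar_of_atBot hk hm,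
      fun c₀ hc => RandomBinaryMatrix.tendsto_probRank_eq_nStar hk hc (hm.mono fun n h => h.1),
      RandomBinaryMatrix.tendsto_probRank_eq_nStar_of_atTop hk hm⟩⟩
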